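/- Let $m,n\ge 0$. Put $\bar i=0$ for $1\le i\le m$ and $\bar i=1$ for $m<i\le m+n$. Let $\mathcal A$ be the free supercommutative $\mathbb C$-algebra on generators $x_{ij}$ ($1\le i,j\le m+n$), $x_{ij}$ having parity $\bar i+\bar j$; that is, $\mathcal A$ is the exterior algebra on the odd $x_{ij}$ over the polynomial ring $P=\mathbb C[x_{ij}:\bar i=\bar j]$. Let $K$ be the algebraic closure of the fraction field of $P$, and let $\Lambda\supset\mathcal A$ be the exterior algebra over $K$ on the odd $x_{ij}$. For a supercommutative algebra $R$, an even $(m|n)$-supermatrix over $R$ is an even element $Y=\sum_{i,j}y_{ij}\otimes e_{ij}$ of the superalgebra $R\otimes\mathrm{End}(\mathbb C^{m|n})$, where $y_{ij}\in R$ has parity $\bar i+\bar j$ and $e_{ij}$ are the matrix units. Supermatrices are multiplied in this tensor product of superalgebras, so $(YZ)_{il}=\sum_j(-1)^{(\bar i+\bar j)(\bar j+\bar l)}y_{ij}z_{jl}$. The generic supermatrix is $X=\sum x_{ij}\otimes e_{ij}$. For $k>0$ work in $\mathcal A\otimes\mathrm{End}((\mathbb C^{m|n})^{\otimes k})$. Let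 $X_a=\sum x_{ij}\otimes 1^{\otimes(a-1)}\otimes e_{ij}\otimes 1^{\otimes(k-a)}$. Let $\mathcal E^{(1^k)}=\frac1{k!}\sum_{\sigma\in\mathfrak S_k}\mathrm{sgn}(\sigma)P_\sigma$, where $$P_\sigma(e_{i_1}\otimes\cdots\otimes e_{i_k})=(-1)^{\sum_{a<b,\ \sigma(a)>\sigma(b)}\bar i_a\bar i_b}\;e_{i_{\sigma^{-1}(1)}}\otimes\cdots\otimes e_{i_{\sigma^{-1}(k)}}.$$ Let $\mathrm{str}_{1,\dots,k}$ be the full supertrace, i.e. the $\mathcal A$-linear map $1\otimes\mathrm{str}$, where $\mathrm{str}(T)=\sum_{I}(-1)^{\bar i_1+\cdots+\bar i_k}T_{II}$ for $T\in\mathrm{End}((\mathbb C^{m|n})^{\otimes k})$, the sum being over the basis vectors $e_I=e_{i_1}\otimes\cdots\otimes e_{i_k}$ and $T_{II}$ denoting the diagonal matrix entry of $T$. Put $$\alpha_k=\mathrm{str}_{1,\dots,k}\,\mathcal E^{(1^k)}X_1\cdots X_k\in\mathcal A .$$ Define polynomials $\mathbb S_k$ in $x_1,\dots,x_m,y_1,\dots,y_n$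 by $\prod_{i=1}^m(1-x_it)^{-1}\prod_{j=1}^n(1+y_jt)=\sum_{k\ge0}\mathbb S_kt^k$, put $\mathbb S_k=0$ for $k<0$, and for $\lambda=(\lambda_1,\dots,\lambda_l)$ let $\mathbb S_\lambda=\det(\mathbb S_{\lambda_i-i+j})_{1\le i,j\le l}$. Even elements $\omega_1,\dots,\omega_m,\varpi_1,\dots,\varpi_n\in\Lambda$ are called eigenvalues of $X$ if there is an invertible even supermatrix $U$ over $\Lambda$ with $U^{-1}XU=\mathrm{diag}(\omega_1,\dots,\omega_m,\varpi_1,\dots,\varpi_n)$ (product of supermatrices as above). **Proposition.** Eigenvalues of $X$ exist, and for all eigenvalues $\omega_1,\dots,\omega_m,\varpi_1,\dots,\varpi_n$ of $X$ and every $k>0$, $$\alpha_k=\mathbb S_{(1^k)}(\omega_1,\dots,\omega_m,-\varpi_1,\dots,-\varpi_n)\quad\text{in }\Lambda .$$ -/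

import Mathlib

noncomputable section

/-! ### Operators on a super vector space with coefficients in a superalgebra

Let `V` be the complex super vector space with basis `e_j`, `j : J`, where `e_j` has parity `p j`.
An even element of the superalgebra `R ⊗ End(V)` is written uniquely as `∑ A i j ⊗ E i j`, where
`E i j` is the matrix unit `e_j ↦ e_i` and `A i j : R` has parity `p i + p j`. It is represented
by its matrix of coefficients `A`. -/

/-- All entries `A i j` are homogeneous of parity `p i + p j` for the given `ℤ/2`-grading. -/
def IsEvenOperator {J S R : Type*} [CommRing S] [Ring R] [Module S R]
    (p : J → ZMod 2) (gr : ZMod 2 → Submodule S R) (A : Matrix J J R) : Prop :=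
  ∀ i j, A i j ∈ gr (p i + p j)

/-- The product of `R ⊗ End(V)` (tensor product of superalgebras) on even elements:
`(a ⊗ E i j) (b ⊗ E j l) = (-1) ^ ((p i + p j) (p j + p l)) a b ⊗ E i l`. -/
def superMul {J R : Type*} [Fintype J] [Ring R] (p : J → ZMod 2) (A B : Matrix J J R) :
    Matrix J J R :=
  Matrix.of fun i l => ∑ j, ((-1 : ℤˣ) ^ ((p i + p j) * (p j + p l))) • (A i j * B j l)

/-- The supertrace. -/
def superTrace {J R : Type*} [Fintype J] [Ring R] (p : J → ZMod 2) (A : Matrix J J R) : R :=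
  ∑ i, ((-1 : ℤˣ) ^ (p i)) • A i i

/-! ### Tensor powers

The basis of `V^{⊗k}` consists of the `e_I = e_{I 0} ⊗ ⋯ ⊗ e_{I (k-1)}`, `I : Fin k → J`. -/

/-- The parity of `e_I`. -/
def tensorParity {J : Type*} (p : J → ZMod 2) (k : ℕ) : (Fin k → J) → ZMod 2 :=
  fun I => ∑ a, p (I a)

/-- `X_a = ∑ X i j ⊗ 1 ⊗ ⋯ ⊗ e_{ij} ⊗ ⋯ ⊗ 1` with `e_{ij}` in the tensor factor `a`. By the sign
rule, `1 ⊗ ⋯ ⊗ e_{ij} ⊗ ⋯ ⊗ 1` multiplies by `(-1) ^ ((p i + p j) * (p (J 0) + ⋯ + p (J (a-1))))`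
when it is applied to `e_J`. -/
def tensorSlot {J R : Type*} [DecidableEq J] [Ring R] (p : J → ZMod 2) {k : ℕ} (a : Fin k)
    (X : Matrix J J R) : Matrix (Fin k → J) (Fin k → J) R :=
  Matrix.of fun I J' =>
    if ∀ b, b ≠ a → I b = J' b then
      ((-1 : ℤˣ) ^ ((p (I a) + p (J' a)) * ∑ b ∈ Finset.univ.filter (· < a), p (J' b))) •
        X (I a) (J' a)
    else 0

/-- The operator `P_σ` of the symmetric group on `V^{⊗k}`:
`e_J ↦ (-1) ^ (∑_{a < b, σ a > σ b} p (J a) * p (J b)) e_{J ∘ σ⁻¹}`. -/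
def permOperator {J : Type*} (R : Type*) [DecidableEq J] [Ring R] (p : J → ZMod 2) {k : ℕ}
    (σ : Equiv.Perm (Fin k)) : Matrix (Fin k → J) (Fin k → J) R :=
  Matrix.of fun I J' =>
    if I = J' ∘ ⇑σ⁻¹ then
      ((-1 : ℤˣ) ^ (∑ ab ∈ Finset.univ.filter
          (fun ab : Fin k × Fin k => ab.1 < ab.2 ∧ σ ab.2 < σ ab.1), p (J' ab.1) * p (J' ab.2))) •
        (1 : R)
    else 0

/-- The primitive idempotent `E^{(1^k)} = (1 / k!) ∑_σ sgn(σ) σ` acting on `V^{⊗k}`. -/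
def antisymmetrizer {J : Type*} (R : Type*) [DecidableEq J] [Ring R] [Algebra ℂ R]
    (p : J → ZMod 2) (k : ℕ) : Matrix (Fin k → J) (Fin k → J) R :=
  ((k.factorial : ℂ)⁻¹) • ∑ σ : Equiv.Perm (Fin k), Equiv.Perm.sign σ • permOperator R p σ

/-- `str_{1,…,k} (E^{(1^k)} X_1 ⋯ X_k)`. -/
def superAlpha {J R : Type*} [Fintype J] [DecidableEq J] [Ring R] [Algebra ℂ R]
    (p : J → ZMod 2) (k : ℕ) (X : Matrix J J R) : R :=
  superTrace (tensorParity p k)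
    ((List.ofFn fun a : Fin k => tensorSlot p a X).foldl (superMul (tensorParity p k))
      (antisymmetrizer R p k))

/-! ### Schur supersymmetric polynomials -/

/-- `∏ i, (1 - x_i t)⁻¹ * ∏ j, (1 + y_j t)`, where `x_i = X (inl i)` and `y_j = X (inr j)`. -/
def superSchurSeries (m n : ℕ) : PowerSeries (MvPolynomial (Fin m ⊕ Fin n) ℂ) :=
  (∏ i : Fin m, PowerSeries.invOfUnit
      (1 - PowerSeries.C (MvPolynomial.X (Sum.inl i)) * PowerSeries.X) 1) *
    ∏ j : Fin n, (1 + PowerSeries.C (MvPolynomial.X (Sum.inr j)) * PowerSeries.X)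

/-- The polynomial `S_k`, which is zero for negative `k`. -/
def superSchurRow (m n : ℕ) (k : ℤ) : MvPolynomial (Fin m ⊕ Fin n) ℂ :=
  if 0 ≤ k then PowerSeries.coeff k.toNat (superSchurSeries m n) else 0

/-- The Schur supersymmetric polynomial `S_lam = det (S_{lam_i - i + j})`. -/
def superSchur (m n : ℕ) {l : ℕ} (lam : Fin l → ℕ) : MvPolynomial (Fin m ⊕ Fin n) ℂ :=
  Matrix.det (Matrix.of fun i j : Fin l =>
    superSchurRow m n ((lam i : ℤ) - ((i : ℕ) : ℤ) + ((j : ℕ) : ℤ)))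

/-! ### The generic supermatrix -/

/-- The parity of the basis vectors of `ℂ^{m|n}`. -/
def stdParity (m n : ℕ) : Fin m ⊕ Fin n → ZMod 2 := Sum.elim (fun _ => 0) (fun _ => 1)

/-- Positions of the even entries. -/
abbrev EvenIdx (m n : ℕ) := (Fin m × Fin m) ⊕ (Fin n × Fin n)

/-- Positions of the odd entries. -/
abbrev OddIdx (m n : ℕ) := (Fin m × Fin n) ⊕ (Fin n × Fin m)

/-- The polynomial ring in the even coordinates. -/
abbrev EvenCoord (m n : ℕ) := MvPolynomial (EvenIdx m n) ℂ

/-- The coordinate superalgebra of `Mat_{m|n}`: the free supercommutative algebra on even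
generators `x_{ij}` (`i`, `j` of equal parity) and odd generators `x_{ij}` (`i`, `j` of different
parity), that is, the exterior algebra on the odd generators over the polynomial ring in the even
generators. -/
abbrev CoordSuperalgebra (m n : ℕ) :=
  ExteriorAlgebra (EvenCoord m n) (OddIdx m n → EvenCoord m n)

/-- The generic supermatrix `X = (x_{ij})`. -/
def genericSupermatrix (m n : ℕ) :
    Matrix (Fin m ⊕ Fin n) (Fin m ⊕ Fin n) (CoordSuperalgebra m n) :=
  Matrix.fromBlocks
    (Matrix.of fun i j => algebraMap (EvenCoord m n) _ (MvPolynomial.X (Sum.inl (i, j))))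
    (Matrix.of fun i j => ExteriorAlgebra.ι (EvenCoord m n) (Pi.single (Sum.inl (i, j)) 1))
    (Matrix.of fun i j => ExteriorAlgebra.ι (EvenCoord m n) (Pi.single (Sum.inr (i, j)) 1))
    (Matrix.of fun i j => algebraMap (EvenCoord m n) _ (MvPolynomial.X (Sum.inr (i, j))))

/-! ### Eigenvalues -/

/-- The algebraic closure of the fraction field of the polynomial ring in the even coordinates. -/
abbrev EigenField (m n : ℕ) := AlgebraicClosure (FractionRing (EvenCoord m n))

/-- The coordinate superalgebra with scalars extended to the algebraic closure of the fraction
field of the polynomial ring in the even coordinates. -/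
abbrev ExtSuperalgebra (m n : ℕ) := ExteriorAlgebra (EigenField m n) (OddIdx m n → EigenField m n)

/-- The `ℤ/2`-grading. -/
abbrev extGrading (m n : ℕ) : ZMod 2 → Submodule (EigenField m n) (ExtSuperalgebra m n) :=
  CliffordAlgebra.evenOdd (0 : QuadraticForm (EigenField m n) (OddIdx m n → EigenField m n))

/-- The extension of scalars `Λ_S(S^ι) → Λ_K(K^ι)`, identical on the generators. -/
def exteriorExtendScalars (S K ι : Type*) [CommRing S] [CommRing K] [Algebra S K] :
    ExteriorAlgebra S (ι → S) →+* ExteriorAlgebra K (ι → K) :=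
  (ExteriorAlgebra.lift S
    ⟨((ExteriorAlgebra.ι K).restrictScalars S) ∘ₗ (Algebra.linearMap S K).compLeft ι,
      fun _ => ExteriorAlgebra.ι_sq_zero _⟩ :
    ExteriorAlgebra S (ι → S) →ₐ[S] ExteriorAlgebra K (ι → K)).toRingHom

/-- The canonical inclusion of the coordinate superalgebra. -/
def coordToExt (m n : ℕ) : CoordSuperalgebra m n →+* ExtSuperalgebra m n :=
  exteriorExtendScalars (EvenCoord m n) (EigenField m n) (OddIdx m n)

/-- Even elements of an exterior algebra are central. -/
theorem even_commute {K M : Type*} [CommRing K] [AddCommGroup M] [Module K M]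
    {x : ExteriorAlgebra K M}
    (hx : x ∈ CliffordAlgebra.evenOdd (0 : QuadraticForm K M) 0) (y : ExteriorAlgebra K M) :
    Commute x y := by
  have key : ∀ (a b c : M), Commute (ExteriorAlgebra.ι K a * ExteriorAlgebra.ι K b)
      (ExteriorAlgebra.ι K c) := by
    intro a b c
    have h1 := eq_neg_of_add_eq_zero_left (ExteriorAlgebra.ι_add_mul_swap (R := K) b c)
    have h2 := eq_neg_of_add_eq_zero_left (ExteriorAlgebra.ι_add_mul_swap (R := K) a c)
    show _ * _ = _ * _
    rw [mul_assoc, h1, mul_neg, ← mul_assoc, h2, neg_mul, neg_neg, mul_assoc]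
  have key2 : ∀ (a b : M) (y : ExteriorAlgebra K M),
      Commute (ExteriorAlgebra.ι K a * ExteriorAlgebra.ι K b) y := by
    intro a b y
    induction y using ExteriorAlgebra.induction with
    | algebraMap r => exact Algebra.commute_algebraMap_right r _
    | ι c => exact key a b c
    | mul u v hu hv => exact hu.mul_right hv
    | add u v hu hv => exact hu.add_right hv
  induction x, hx using CliffordAlgebra.even_induction with
  | algebraMap r => exact Algebra.commute_algebraMap_left r y
  | add x y hx hy h1 h2 => exact h1.add_left h2
  | ι_mul_ι_mul a b x hx h => exact (key2 a b y).mul_left h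

/-- The even part of `Λ_K(M)`. -/
abbrev EvenPart (K M : Type*) [CommRing K] [AddCommGroup M] [Module K M] :=
  CliffordAlgebra.even (0 : QuadraticForm K M)

/-- The even part of an exterior algebra is a commutative ring. -/
instance evenPartCommRing (K M : Type*) [CommRing K] [AddCommGroup M] [Module K M] :
    CommRing (EvenPart K M) :=
  { (inferInstance : Ring (EvenPart K M)) with
    mul_comm := fun x y => Subtype.ext (even_commute x.2 y.1) }

/-- The commutative ring of even elements of `ExtSuperalgebra m n`. -/
abbrev ExtEven (m n : ℕ) := EvenPart (EigenField m n) (OddIdx m n → EigenField m n)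

/-- `ω` and `ϖ` are the even and the odd eigenvalues of the even supermatrix `Y`: there is an
invertible even supermatrix `U` with `U⁻¹ Y U = diag(ω_1, …, ω_m, ϖ_1, …, ϖ_n)` in the
superalgebra of `(m|n)`-supermatrices. -/
def IsSuperEigenvalues {m n : ℕ} (Y : Matrix (Fin m ⊕ Fin n) (Fin m ⊕ Fin n) (ExtSuperalgebra m n))
    (ω : Fin m → ExtEven m n) (ϖ : Fin n → ExtEven m n) : Prop :=
  ∃ U V : Matrix (Fin m ⊕ Fin n) (Fin m ⊕ Fin n) (ExtSuperalgebra m n),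
    IsEvenOperator (stdParity m n) (extGrading m n) U ∧
    IsEvenOperator (stdParity m n) (extGrading m n) V ∧
    superMul (stdParity m n) U V = 1 ∧ superMul (stdParity m n) V U = 1 ∧
    superMul (stdParity m n) (superMul (stdParity m n) V Y) U =
      Matrix.diagonal (Sum.elim (fun i => (ω i : ExtSuperalgebra m n))
        (fun j => (ϖ j : ExtSuperalgebra m n)))

end

/-! The identity says that `superAlpha` is a conjugation invariant, evaluated on a diagonal
supermatrix; existence of eigenvalues says that the generic supermatrix is conjugate to a diagonal
one. Signs are tamed first. The cocycle in the product of supermatrices is a coboundary, so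
`signTwist` turns that product into the ordinary matrix product. For even supermatrices over a
supercommutative algebra, operators in different tensor slots then commute, so `tensorPow` is
multiplicative (`tensorPow_mul`). It commutes with every P_σ (`permOperator_mul_tensorPow`), and the
supertrace is cyclic on even operators. Hence each str(P_σ X_1⋯X_k) is invariant under conjugation
(`permTrace_conj`). For a diagonal matrix the signed sum over σ reduces, for each basis vector e_I,
to a character sum over the stabilizer of I (`sum_stabilizer_sign`). It vanishes when an even index
repeats and is otherwise the order of the stabilizer. The multinomial theorem turns the sum over I
into k! times the coefficient of t^k in ∏(1+ω_i t)∏(1+ϖ_j t)⁻¹. Jacobi–Trudi for a column, proved by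
inverting a unitriangular Toeplitz matrix, identifies this coefficient with the Schur polynomial
(`map_superSchur_column`). For existence, the two even blocks of X have jointly distinct eigenvalues
over K, because this holds for one specialization (`separable_charpoly_mul_charpoly`). So the body
of X, its reduction modulo the odd generators, is diagonalizable. The kernel of reduction is
nilpotent, hence the spectral idempotents lift to K[X] and yield an even diagonalizing matrix
(`exists_conj_eq_diagonal`). -/

noncomputable section

/-! ### Removing the signs from the supermatrix product -/

section Twist

variable {J R : Type*} [Ring R] (p : J → ZMod 2)

/-- The change of signs which turns the product of supermatrices into the ordinary product of
matrices. -/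
def signTwist (A : Matrix J J R) : Matrix J J R :=
  Matrix.of fun i j => ((-1 : ℤˣ) ^ ((p i + p j) * p j)) • A i j

theorem signTwist_apply (A : Matrix J J R) (i j : J) :
    signTwist p A i j = ((-1 : ℤˣ) ^ ((p i + p j) * p j)) • A i j := rfl

theorem signTwist_signTwist (A : Matrix J J R) : signTwist p (signTwist p A) = A := by
  ext i j
  simp only [signTwist_apply, smul_smul, Int.units_mul_self, one_smul]

theorem signTwist_injective :
    Function.Injective (signTwist p : Matrix J J R → Matrix J J R) :=
  Function.LeftInverse.injective (signTwist_signTwist p)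

/-- Modulo 2, (i+j)(j+l) = (i+j)j + (j+l)l + (i+l)l: the sign cocycle of the super product is the
coboundary of the twisting exponent. -/
theorem signTwist_superMul [Fintype J] (A B : Matrix J J R) :
    signTwist p (superMul p A B) = signTwist p A * signTwist p B := by
  ext i l
  simp only [signTwist_apply, superMul, Matrix.of_apply, Matrix.mul_apply, Finset.smul_sum]
  refine Finset.sum_congr rfl fun j _ => ?_
  rw [smul_mul_smul_comm, smul_smul, ← uzpow_add, ← uzpow_add]
  congr 2
  generalize p i = a
  generalize p j = b
  generalize p l = c
  revert a b c
  decide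

theorem signTwist_eq_self {A : Matrix J J R} (h : ∀ i j, p i ≠ p j → A i j = 0) :
    signTwist p A = A := by
  ext i j
  rw [signTwist_apply]
  by_cases hij : p i = p j
  · simp [hij, CharTwo.add_self_eq_zero]
  · rw [h i j hij, smul_zero]

theorem signTwist_diagonal [DecidableEq J] (d : J → R) :
    signTwist p (Matrix.diagonal d) = Matrix.diagonal d :=
  signTwist_eq_self p fun _ _ h => Matrix.diagonal_apply_ne _ fun e => h (congrArg p e)

theorem signTwist_one [DecidableEq J] : signTwist p (1 : Matrix J J R) = 1 :=
  signTwist_diagonal p _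

theorem superTrace_signTwist [Fintype J] (A : Matrix J J R) :
    superTrace p (signTwist p A) = superTrace p A := by
  simp [superTrace, signTwist_apply, CharTwo.add_self_eq_zero]

theorem signTwist_foldl_superMul [Fintype J] [DecidableEq J] (l : List (Matrix J J R))
    (A : Matrix J J R) :
    signTwist p (l.foldl (superMul p) A) = signTwist p A * (l.map (signTwist p)).prod := by
  induction l generalizing A with
  | nil => simp
  | cons B l ih => rw [List.foldl_cons, ih, signTwist_superMul, List.map_cons, List.prod_cons,
      mul_assoc]

end Twist

/-! ### Operators acting in one tensor factor -/

section Slots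

theorem eq_update_of_forall_ne {J : Type*} {k : ℕ} {a : Fin k} {I J' : Fin k → J} (h : ∀ b, b ≠ a → I b = J' b) :
    J' = Function.update I a (J' a) := by
  ext b
  by_cases hb : b = a
  · subst hb; simp
  · simp [hb, h b hb]

theorem sum_eq_lt_add_add_gt {k : ℕ} (a : Fin k) (f : Fin k → ZMod 2) :
    ∑ b, f b = ∑ b ∈ Finset.univ.filter (· < a), f b + f a +
      ∑ b ∈ Finset.univ.filter (a < ·), f b := by
  have h : f a = ∑ b, (if b = a then f b else 0 : ZMod 2) := by simp
  rw [h, Finset.sum_filter, Finset.sum_filter, ← Finset.sum_add_distrib, ← Finset.sum_add_distrib]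
  refine Finset.sum_congr rfl fun b _ => ?_
  rcases lt_trichotomy b a with h | h | h
  · simp [h, h.ne, h.not_gt]
  · simp [h]
  · simp [h, h.ne', h.not_gt]

theorem tensorParity_update {J : Type*} (p : J → ZMod 2) {k : ℕ} (a : Fin k) (I : Fin k → J) (j : J) :
    tensorParity p k (Function.update I a j) = tensorParity p k I + p (I a) + p j := by
  rw [tensorParity, tensorParity, sum_eq_lt_add_add_gt a, sum_eq_lt_add_add_gt a fun b => p (I b),
    Function.update_self]
  have h1 : ∑ b ∈ Finset.univ.filter (· < a), p (Function.update I a j b) =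
      ∑ b ∈ Finset.univ.filter (· < a), p (I b) :=
    Finset.sum_congr rfl fun b hb => by rw [Function.update_of_ne (Finset.mem_filter.1 hb).2.ne]
  have h2 : ∑ b ∈ Finset.univ.filter (a < ·), p (Function.update I a j b) =
      ∑ b ∈ Finset.univ.filter (a < ·), p (I b) :=
    Finset.sum_congr rfl fun b hb => by rw [Function.update_of_ne (Finset.mem_filter.1 hb).2.ne']
  rw [h1, h2]
  have h3 : (2 : ZMod 2) = 0 := rfl
  linear_combination (-p (I a)) * h3

variable {J R : Type*} [DecidableEq J] [Ring R] (p : J → ZMod 2) {k : ℕ}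

/-- The operator `X_a` in the sign convention of `signTwist`. -/
def tailSlot (a : Fin k) (X : Matrix J J R) : Matrix (Fin k → J) (Fin k → J) R :=
  Matrix.of fun I J' =>
    if ∀ b, b ≠ a → I b = J' b then
      ((-1 : ℤˣ) ^ ((p (I a) + p (J' a)) * ∑ b ∈ Finset.univ.filter (a < ·), p (J' b))) •
        X (I a) (J' a)
    else 0

theorem tailSlot_update (a : Fin k) (X : Matrix J J R) (I : Fin k → J) (j : J) :
    tailSlot p a X I (Function.update I a j) =
      ((-1 : ℤˣ) ^ ((p (I a) + p j) * ∑ b ∈ Finset.univ.filter (a < ·), p (I b))) •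
        X (I a) j := by
  have h : ∀ b, b ≠ a → I b = Function.update I a j b := fun b hb => by simp [hb]
  have h2 : ∑ b ∈ Finset.univ.filter (a < ·), p (Function.update I a j b) =
      ∑ b ∈ Finset.univ.filter (a < ·), p (I b) :=
    Finset.sum_congr rfl fun b hb => by rw [Function.update_of_ne (Finset.mem_filter.1 hb).2.ne']
  rw [tailSlot, Matrix.of_apply, if_pos h, Function.update_self, h2]

theorem tailSlot_apply_eq_zero {a : Fin k} {X : Matrix J J R} {I J' : Fin k → J}
    (h : ¬ ∀ b, b ≠ a → I b = J' b) : tailSlot p a X I J' = 0 := by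
  rw [tailSlot, Matrix.of_apply, if_neg h]

/-- The twist on the tensor power multiplies the exponent by the total parity of the source. The
contribution of the factors before a cancels, that of factor a is the twist of X itself, and that of
the factors after a remains. -/
theorem signTwist_tensorSlot (a : Fin k) (X : Matrix J J R) :
    signTwist (tensorParity p k) (tensorSlot p a X) = tailSlot p a (signTwist p X) := by
  ext I J'
  rw [signTwist_apply]
  by_cases h : ∀ b, b ≠ a → I b = J' b
  · have hI := eq_update_of_forall_ne fun b hb => (h b hb).symm
    rw [tensorSlot, tailSlot, Matrix.of_apply, Matrix.of_apply, if_pos h, if_pos h,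
      signTwist_apply, smul_smul, smul_smul, ← uzpow_add, ← uzpow_add]
    congr 2
    rw [hI, tensorParity_update, Function.update_self]
    rw [tensorParity, sum_eq_lt_add_add_gt a fun b => p (J' b)]
    generalize ∑ b ∈ Finset.univ.filter (· < a), p (J' b) = s
    generalize ∑ b ∈ Finset.univ.filter (a < ·), p (J' b) = t
    generalize p (I a) = x
    generalize p (J' a) = y
    revert s t x y
    decide
  · rw [tensorSlot, tailSlot, Matrix.of_apply, Matrix.of_apply, if_neg h, if_neg h, smul_zero]

/-- Only intermediate indices that agree with I off a contribute. The factors after a are never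
altered, so the sign exponents add: (x+y)s + (y+z)s = (x+z)s. -/
theorem tailSlot_mul [Fintype J] (a : Fin k) (X Y : Matrix J J R) :
    tailSlot p a (X * Y) = tailSlot p a X * tailSlot p a Y := by
  ext I J'
  rw [Matrix.mul_apply]
  have key : ∑ K, tailSlot p a X I K * tailSlot p a Y K J' =
      ∑ j, tailSlot p a X I (Function.update I a j) *
        tailSlot p a Y (Function.update I a j) J' := by
    refine (Finset.sum_of_injOn (Function.update I a)
      (Function.update_injective I a).injOn (by simp) ?_ (fun _ _ => rfl)).symm
    intro K _ hK
    rw [tailSlot_apply_eq_zero p (J' := K), zero_mul]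
    intro h
    exact hK ⟨K a, by simp, (eq_update_of_forall_ne h).symm⟩
  rw [key]
  by_cases h : ∀ b, b ≠ a → I b = J' b
  · rw [eq_update_of_forall_ne h]
    generalize J' a = l
    rw [tailSlot_update, Matrix.mul_apply, Finset.smul_sum]
    refine Finset.sum_congr rfl fun j _ => ?_
    have h2 := tailSlot_update p a Y (Function.update I a j) l
    rw [Function.update_idem, Function.update_self] at h2
    rw [h2, tailSlot_update, smul_mul_smul_comm, ← uzpow_add]
    have h3 : ∑ b ∈ Finset.univ.filter (a < ·), p (Function.update I a j b) =
        ∑ b ∈ Finset.univ.filter (a < ·), p (I b) :=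
      Finset.sum_congr rfl fun b hb => by
        rw [Function.update_of_ne (Finset.mem_filter.1 hb).2.ne']
    rw [h3]
    congr 2
    generalize ∑ b ∈ Finset.univ.filter (a < ·), p (I b) = s
    generalize p (I a) = x
    generalize p j = y
    generalize p l = z
    revert s x y z
    decide
  · rw [tailSlot_apply_eq_zero p h]
    refine (Finset.sum_eq_zero fun j _ => ?_).symm
    rw [tailSlot_apply_eq_zero p (J' := J'), mul_zero]
    intro h'
    exact h fun b hb => by simpa [hb] using h' b hb

theorem tailSlot_diagonal (a : Fin k) (d : J → R) :
    tailSlot p a (Matrix.diagonal d) = Matrix.diagonal fun I => d (I a) := by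
  ext I J'
  by_cases h : ∀ b, b ≠ a → I b = J' b
  · rw [eq_update_of_forall_ne h]
    generalize J' a = l
    rw [tailSlot_update]
    by_cases hl : I a = l
    · subst hl
      simp [CharTwo.add_self_eq_zero]
    · rw [Matrix.diagonal_apply_ne _ hl, smul_zero, Matrix.diagonal_apply_ne]
      intro e
      exact hl (by simpa using congrFun e a)
  · rw [tailSlot_apply_eq_zero p h, Matrix.diagonal_apply_ne]
    rintro rfl
    exact h fun _ _ => rfl

theorem tailSlot_one (a : Fin k) : tailSlot p a (1 : Matrix J J R) = 1 :=
  tailSlot_diagonal p a _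

/-- Entries of a product of operators in two different tensor factors. -/
theorem tailSlot_mul_tailSlot_apply [Fintype J] {a b : Fin k} (hab : a ≠ b) (X Y : Matrix J J R)
    (I : Fin k → J) (i j : J) :
    (tailSlot p a X * tailSlot p b Y) I (Function.update (Function.update I a i) b j) =
      tailSlot p a X I (Function.update I a i) *
        tailSlot p b Y (Function.update I a i) (Function.update (Function.update I a i) b j) := by
  rw [Matrix.mul_apply]
  refine Finset.sum_eq_single _ (fun K _ hK => ?_) (by simp)
  by_contra hne
  have h1 : ∀ c, c ≠ a → I c = K c := by
    by_contra h
    exact hne (by rw [tailSlot_apply_eq_zero p h, zero_mul])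
  have h2 : ∀ c, c ≠ b → K c = Function.update (Function.update I a i) b j c := by
    by_contra h
    exact hne (by rw [tailSlot_apply_eq_zero p h, mul_zero])
  refine hK ?_
  rw [eq_update_of_forall_ne h1, h2 a hab]
  simp [hab]

theorem tailSlot_mul_tailSlot_apply_eq_zero [Fintype J] {a b : Fin k} (X Y : Matrix J J R)
    {I J' : Fin k → J} (h : ¬ ∀ c, c ≠ a → c ≠ b → I c = J' c) :
    (tailSlot p a X * tailSlot p b Y) I J' = 0 := by
  rw [Matrix.mul_apply]
  refine Finset.sum_eq_zero fun K _ => ?_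
  by_contra hne
  have h1 : ∀ c, c ≠ a → I c = K c := by
    by_contra h
    exact hne (by rw [tailSlot_apply_eq_zero p h, zero_mul])
  have h2 : ∀ c, c ≠ b → K c = J' c := by
    by_contra h
    exact hne (by rw [tailSlot_apply_eq_zero p h, mul_zero])
  exact h fun c hca hcb => (h1 c hca).trans (h2 c hcb)

end Slots

/-! ### Commutation of operators in different tensor factors -/

section Commute

theorem sum_gt_update {J : Type*} (p : J → ZMod 2) {k : ℕ} {a b : Fin k} (hab : a < b)
    (I : Fin k → J) (j : J) :
    ∑ c ∈ Finset.univ.filter (a < ·), p (Function.update I b j c) =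
      ∑ c ∈ Finset.univ.filter (a < ·), p (I c) + p (I b) + p j := by
  have hb : b ∈ Finset.univ.filter (a < ·) := by simpa using hab
  rw [← Finset.add_sum_erase _ _ hb, ← Finset.add_sum_erase _ (fun c => p (I c)) hb,
    Function.update_self]
  have h : ∑ c ∈ (Finset.univ.filter (a < ·)).erase b, p (Function.update I b j c) =
      ∑ c ∈ (Finset.univ.filter (a < ·)).erase b, p (I c) :=
    Finset.sum_congr rfl fun c hc => by rw [Function.update_of_ne (Finset.mem_erase.1 hc).1]
  rw [h]
  have h3 : (2 : ZMod 2) = 0 := rfl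
  linear_combination (-p (I b)) * h3

theorem sum_gt_update_of_le {J : Type*} (p : J → ZMod 2) {k : ℕ} {a b : Fin k} (hab : b ≤ a)
    (I : Fin k → J) (j : J) :
    ∑ c ∈ Finset.univ.filter (a < ·), p (Function.update I b j c) =
      ∑ c ∈ Finset.univ.filter (a < ·), p (I c) :=
  Finset.sum_congr rfl fun c hc => by
    rw [Function.update_of_ne (hab.trans_lt (Finset.mem_filter.1 hc).2).ne']

/-- Homogeneous elements commute up to the sign given by their parities. -/
def IsSuperCommutative {S R : Type*} [CommRing S] [Ring R] [Module S R]
    (gr : ZMod 2 → Submodule S R) : Prop :=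
  ∀ i j, ∀ x ∈ gr i, ∀ y ∈ gr j, x * y = ((-1 : ℤˣ) ^ (i * j)) • (y * x)

variable {J S R : Type*} [DecidableEq J] [CommRing S] [Ring R] [Module S R] {p : J → ZMod 2}
  {gr : ZMod 2 → Submodule S R} {k : ℕ}

/-- Acting first in slot b changes the parity of a factor after a, which alters the sign of the
operator in slot a. This change is exactly the sign from exchanging the two coefficients. -/
theorem tailSlot_commute_of_lt [Fintype J] (hgr : IsSuperCommutative gr) {X Y : Matrix J J R}
    (hX : IsEvenOperator p gr X) (hY : IsEvenOperator p gr Y) {a b : Fin k} (hab : a < b) :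
    Commute (tailSlot p a X) (tailSlot p b Y) := by
  ext I J'
  by_cases h : ∀ c, c ≠ a → c ≠ b → I c = J' c
  · have hJ : J' = Function.update (Function.update I a (J' a)) b (J' b) := by
      ext c
      by_cases hb : c = b
      · subst hb; simp
      · by_cases ha : c = a
        · subst ha; simp [hb]
        · simp [ha, hb, h c ha hb]
    rw [hJ]
    generalize J' a = i
    generalize J' b = j
    rw [tailSlot_mul_tailSlot_apply p hab.ne, Function.update_comm hab.ne,
      tailSlot_mul_tailSlot_apply p hab.ne', Function.update_comm hab.ne', tailSlot_update,
      tailSlot_update, tailSlot_update, Function.update_comm hab.ne, tailSlot_update,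
      sum_gt_update p hab, sum_gt_update_of_le p hab.le, Function.update_of_ne hab.ne,
      Function.update_of_ne hab.ne', smul_mul_smul_comm, smul_mul_smul_comm,
      hgr _ _ _ (hX (I a) i) _ (hY (I b) j), smul_smul, ← uzpow_add, ← uzpow_add, ← uzpow_add]
    congr 2
    have h3 : (2 : ZMod 2) = 0 := rfl
    generalize ∑ c ∈ Finset.univ.filter (a < ·), p (I c) = s
    generalize ∑ c ∈ Finset.univ.filter (b < ·), p (I c) = t
    generalize p (I a) = x
    generalize p (I b) = y
    generalize p i = z
    generalize p j = w
    ring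
  · rw [tailSlot_mul_tailSlot_apply_eq_zero p X Y h,
      tailSlot_mul_tailSlot_apply_eq_zero p Y X fun h' => h fun c ha hb => h' c hb ha]

theorem tailSlot_commute [Fintype J] (hgr : IsSuperCommutative gr) {X Y : Matrix J J R}
    (hX : IsEvenOperator p gr X) (hY : IsEvenOperator p gr Y) {a b : Fin k} (hab : a ≠ b) :
    Commute (tailSlot p a X) (tailSlot p b Y) := by
  rcases hab.lt_or_gt with h | h
  · exact tailSlot_commute_of_lt hgr hX hY h
  · exact (tailSlot_commute_of_lt hgr hY hX h).symm

end Commute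

/-! ### Multiplicativity of tensor powers and commutation with permutations -/

section TensorPower

/-- The inversions of `σ` between odd basis vectors. -/
def inversionParity {k : ℕ} (σ : Equiv.Perm (Fin k)) (u : Fin k → ZMod 2) : ZMod 2 :=
  ∑ ab ∈ Finset.univ.filter (fun ab : Fin k × Fin k => ab.1 < ab.2 ∧ σ ab.2 < σ ab.1),
    u ab.1 * u ab.2

theorem permOperator_apply {J R : Type*} [DecidableEq J] [Ring R] {p : J → ZMod 2} {k : ℕ} (σ : Equiv.Perm (Fin k)) (I J' : Fin k → J) :
    permOperator R p σ I J' = if I = J' ∘ ⇑σ⁻¹ then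
      ((-1 : ℤˣ) ^ inversionParity σ (p ∘ J')) • (1 : R) else 0 := rfl

variable {J R : Type*} [DecidableEq J] [Fintype J] [Ring R] (p : J → ZMod 2)

/-- The product `X_1 ⋯ X_k` in the sign convention of `signTwist`. -/
def tensorPow (k : ℕ) (X : Matrix J J R) : Matrix (Fin k → J) (Fin k → J) R :=
  ((List.finRange k).map fun a => tailSlot p a X).prod

theorem tensorPow_one (k : ℕ) : tensorPow p k (1 : Matrix J J R) = 1 := by
  simp [tensorPow, tailSlot_one]

variable {p} {S : Type*} [CommRing S] [Module S R] {gr : ZMod 2 → Submodule S R}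

/-- Each Y_a is moved past the later X_b; the list has no repetitions, so these lie in different
slots and commute. -/
theorem prod_map_tailSlot_mul {k : ℕ} (hgr : IsSuperCommutative gr) {X Y : Matrix J J R}
    (hX : IsEvenOperator p gr X) (hY : IsEvenOperator p gr Y) (l : List (Fin k)) (hl : l.Nodup) :
    (l.map fun a => tailSlot p a (X * Y)).prod =
      (l.map fun a => tailSlot p a X).prod * (l.map fun a => tailSlot p a Y).prod := by
  induction l with
  | nil => simp
  | cons a l ih =>
    have hc : Commute (tailSlot p a Y) (l.map fun b => tailSlot p b X).prod := by
      refine Commute.list_prod_right _ _ fun Z hZ => ?_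
      obtain ⟨b, hb, rfl⟩ := List.mem_map.1 hZ
      refine tailSlot_commute hgr hY hX ?_
      rintro rfl
      exact (List.nodup_cons.1 hl).1 hb
    simp only [List.map_cons, List.prod_cons]
    rw [ih (List.nodup_cons.1 hl).2, tailSlot_mul]
    simp only [mul_assoc]
    rw [← mul_assoc (tailSlot p a Y), hc.eq, mul_assoc]

theorem tensorPow_mul (k : ℕ) (hgr : IsSuperCommutative gr) {X Y : Matrix J J R}
    (hX : IsEvenOperator p gr X) (hY : IsEvenOperator p gr Y) :
    tensorPow p k (X * Y) = tensorPow p k X * tensorPow p k Y :=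
  prod_map_tailSlot_mul hgr hX hY _ (List.nodup_finRange k)

theorem tensorPow_diagonal (k : ℕ) (d : J → R) :
    tensorPow p k (Matrix.diagonal d) =
      Matrix.diagonal fun I => ((List.finRange k).map fun a => d (I a)).prod := by
  unfold tensorPow
  simp only [tailSlot_diagonal]
  induction List.finRange k with
  | nil => simp
  | cons a l ih => simp [ih]

/-- The increment comes from the inversions that involve a. For b ≠ a the pair {a, b} is inverted
exactly when one of a < b and σ a < σ b holds but not both, so modulo 2 its indicator is the sum of
theirs. -/
theorem inversionParity_update {k : ℕ} (σ : Equiv.Perm (Fin k)) (u : Fin k → ZMod 2) (a : Fin k)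
    (v : ZMod 2) :
    inversionParity σ (Function.update u a v) = inversionParity σ u + (v + u a) *
      (∑ b ∈ Finset.univ.filter (a < ·), u b + ∑ b ∈ Finset.univ.filter (σ a < ·), u (σ⁻¹ b)) := by
  have h1 : ∑ b ∈ Finset.univ.filter (σ a < ·), u (σ⁻¹ b) =
      ∑ b ∈ Finset.univ.filter (σ a < σ ·), u b := by
    rw [Finset.sum_filter, Finset.sum_filter, ← Equiv.sum_comp σ]
    simp
  have h2 : ∀ w : Fin k → ZMod 2, inversionParity σ w =
      ∑ x, ∑ y, if x < y ∧ σ y < σ x then w x * w y else 0 := fun w => by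
    rw [inversionParity, Finset.sum_filter, Fintype.sum_prod_type]
  have h3 : ∀ x y, (if x < y ∧ σ y < σ x then
      Function.update u a v x * Function.update u a v y else 0) =
      (if x < y ∧ σ y < σ x then u x * u y else 0) +
      ((if x = a then (if a < y ∧ σ y < σ a then (v + u a) * u y else 0) else 0) +
      (if y = a then (if x < a ∧ σ a < σ x then (v + u a) * u x else 0) else 0)) := by
    intro x y
    have h2 : (2 : ZMod 2) = 0 := rfl
    by_cases hx : x = a
    · by_cases hy : y = a
      · subst hx; subst hy; simp
      · subst hx
        simp only [Function.update_self, Function.update_of_ne hy, hy, if_true, if_false, add_zero]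
        split_ifs
        · linear_combination (-u x * u y) * h2
        · simp
    · by_cases hy : y = a
      · subst hy
        simp only [Function.update_self, Function.update_of_ne hx, hx, if_true, if_false, zero_add]
        split_ifs
        · linear_combination (-u x * u y) * h2
        · simp
      · simp [hx, hy]
  rw [h1, h2, h2]
  simp only [h3, Finset.sum_add_distrib]
  congr 1
  rw [Finset.sum_comm]
  simp only [Finset.sum_ite_eq', Finset.mem_univ, if_true]
  rw [Finset.sum_filter, Finset.sum_filter, ← Finset.sum_add_distrib, ← Finset.sum_add_distrib,
    Finset.mul_sum]
  refine Finset.sum_congr rfl fun b _ => ?_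
  rcases lt_trichotomy a b with h | h | h
  · by_cases hs : σ b < σ a
    · simp [h, hs, h.not_gt, hs.not_gt]
    · have hs' : σ a < σ b := lt_of_le_of_ne (not_lt.1 hs) fun e => h.ne (σ.injective e)
      simp [h, hs, h.not_gt, hs', CharTwo.add_self_eq_zero]
  · subst h; simp
  · by_cases hs : σ b < σ a
    · simp [h, hs, h.not_gt, hs.not_gt]
    · have hs' : σ a < σ b := lt_of_le_of_ne (not_lt.1 hs) fun e => h.ne' (σ.injective e)
      simp [h, hs, h.not_gt, hs']

/-- Each product has a single possible intermediate index. The signs of X_a and X_{σ a} are governed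
by the parities behind a and behind σ a, and these two sums make up the increment in
`inversionParity_update`. -/
theorem permOperator_mul_tailSlot {k : ℕ} (σ : Equiv.Perm (Fin k)) (a : Fin k)
    (X : Matrix J J R) :
    permOperator R p σ * tailSlot p a X = tailSlot p (σ a) X * permOperator R p σ := by
  ext I J'
  have hl : (permOperator R p σ * tailSlot p a X) I J' =
      permOperator R p σ I (I ∘ σ) * tailSlot p a X (I ∘ σ) J' := by
    rw [Matrix.mul_apply]
    refine Finset.sum_eq_single _ (fun K _ hK => ?_) (by simp)
    rw [permOperator_apply, if_neg, zero_mul]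
    rintro rfl
    exact hK (by ext; simp)
  have hr : (tailSlot p (σ a) X * permOperator R p σ) I J' =
      tailSlot p (σ a) X I (J' ∘ ⇑σ⁻¹) * permOperator R p σ (J' ∘ ⇑σ⁻¹) J' := by
    rw [Matrix.mul_apply]
    refine Finset.sum_eq_single _ (fun K _ hK => ?_) (by simp)
    rw [permOperator_apply, if_neg hK, mul_zero]
  rw [hl, hr, permOperator_apply, permOperator_apply, if_pos rfl, if_pos (by ext; simp)]
  by_cases h : ∀ b, b ≠ a → (I ∘ σ) b = J' b
  · have h' : ∀ b, b ≠ σ a → I b = (J' ∘ ⇑σ⁻¹) b := fun b hb => by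
      have := h (σ⁻¹ b) (by rintro rfl; simp at hb)
      simpa using this
    have hu : p ∘ (I ∘ σ) = Function.update (p ∘ J') a (p (I (σ a))) := by
      rw [eq_update_of_forall_ne fun b hb => (h b hb).symm]
      ext b
      by_cases hb : b = a
      · subst hb; simp
      · simp [hb]
    rw [hu, inversionParity_update]
    simp only [tailSlot, Matrix.of_apply]
    rw [if_pos h, if_pos h', smul_mul_smul_comm, smul_mul_smul_comm, ← uzpow_add, ← uzpow_add,
      one_mul, mul_one]
    have ha : σ⁻¹ (σ a) = a := by simp
    simp only [Function.comp_apply, ha]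
    congr 2
    generalize ∑ b ∈ Finset.univ.filter (a < ·), p (J' b) = s
    generalize ∑ b ∈ Finset.univ.filter (σ a < ·), p (J' (σ⁻¹ b)) = t
    have h2 : (2 : ZMod 2) = 0 := rfl
    linear_combination (p (I (σ a)) + p (J' a)) * s * h2
  · rw [tailSlot_apply_eq_zero p h, tailSlot_apply_eq_zero p (J' := J' ∘ ⇑σ⁻¹), mul_zero, zero_mul]
    intro h'
    refine h fun b hb => ?_
    simpa using h' (σ b) (by simpa using hb)

theorem permOperator_mul_prod_tailSlot {k : ℕ} (σ : Equiv.Perm (Fin k)) (X : Matrix J J R)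
    (l : List (Fin k)) :
    permOperator R p σ * (l.map fun a => tailSlot p a X).prod =
      ((l.map σ).map fun a => tailSlot p a X).prod * permOperator R p σ := by
  induction l with
  | nil => simp
  | cons a l ih =>
    simp only [List.map_cons, List.prod_cons]
    rw [← mul_assoc, permOperator_mul_tailSlot, mul_assoc, ih, mul_assoc]

/-- Conjugation by P_σ only reorders the factors X_1, …, X_k, which commute pairwise. -/
theorem permOperator_mul_tensorPow {k : ℕ} (σ : Equiv.Perm (Fin k)) (hgr : IsSuperCommutative gr)
    {X : Matrix J J R} (hX : IsEvenOperator p gr X) :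
    permOperator R p σ * tensorPow p k X = tensorPow p k X * permOperator R p σ := by
  rw [tensorPow, permOperator_mul_prod_tailSlot]
  congr 1
  refine List.Perm.prod_eq' ?_ ?_
  · refine List.Perm.map _ ((List.perm_ext_iff_of_nodup ?_ (List.nodup_finRange k)).2 ?_)
    · exact (List.nodup_finRange k).map σ.injective
    · exact fun a => by simpa using ⟨σ⁻¹ a, by simp⟩
  · rw [List.pairwise_map]
    refine List.Pairwise.imp (fun {a b} hab => tailSlot_commute hgr hX hX hab) ?_
    exact (List.nodup_finRange k).map σ.injective

end TensorPower

/-! ### Stability of even operators -/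

section Even

theorem tensorParity_comp_perm {J : Type*} {p : J → ZMod 2} {k : ℕ} (I : Fin k → J) (σ : Equiv.Perm (Fin k)) :
    tensorParity p k (I ∘ σ) = tensorParity p k I :=
  Equiv.sum_comp σ fun a => p (I a)

variable {J S R : Type*} [CommRing S] [Ring R] [Module S R] {p : J → ZMod 2}
  {gr : ZMod 2 → Submodule S R}

theorem intUnits_smul_mem_iff (N : Submodule S R) (u : ℤˣ) {x : R} : u • x ∈ N ↔ x ∈ N := by
  rcases Int.units_eq_one_or u with rfl | rfl
  · rw [one_smul]
  · rw [Units.neg_smul, one_smul, neg_mem_iff]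

theorem isEvenOperator_signTwist_iff {A : Matrix J J R} :
    IsEvenOperator p gr (signTwist p A) ↔ IsEvenOperator p gr A := by
  simp only [IsEvenOperator, signTwist_apply, intUnits_smul_mem_iff]

theorem IsEvenOperator.mul [Fintype J] [SetLike.GradedMonoid gr] {A B : Matrix J J R}
    (hA : IsEvenOperator p gr A) (hB : IsEvenOperator p gr B) : IsEvenOperator p gr (A * B) := by
  intro i l
  rw [Matrix.mul_apply]
  refine Submodule.sum_mem _ fun j _ => ?_
  have h : p i + p l = (p i + p j) + (p j + p l) := by
    have h2 : (2 : ZMod 2) = 0 := rfl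
    linear_combination (-p j) * h2
  rw [h]
  exact SetLike.mul_mem_graded (hA i j) (hB j l)

theorem IsEvenOperator.diagonal [DecidableEq J] {d : J → R} (hd : ∀ j, d j ∈ gr 0) :
    IsEvenOperator p gr (Matrix.diagonal d) := by
  intro i j
  by_cases h : i = j
  · subst h
    rw [CharTwo.add_self_eq_zero, Matrix.diagonal_apply_eq]
    exact hd i
  · rw [Matrix.diagonal_apply_ne _ h]
    exact zero_mem _

theorem IsEvenOperator.one [DecidableEq J] [SetLike.GradedMonoid gr] :
    IsEvenOperator p gr (1 : Matrix J J R) :=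
  IsEvenOperator.diagonal fun _ => SetLike.GradedOne.one_mem

variable [DecidableEq J] {k : ℕ}

theorem IsEvenOperator.tailSlot {X : Matrix J J R} (hX : IsEvenOperator p gr X) (a : Fin k) :
    IsEvenOperator (tensorParity p k) gr (tailSlot p a X) := by
  intro I J'
  by_cases h : ∀ b, b ≠ a → I b = J' b
  · rw [eq_update_of_forall_ne h]
    generalize J' a = j
    rw [tailSlot_update, intUnits_smul_mem_iff, tensorParity_update]
    have h2 : tensorParity p k I + (tensorParity p k I + p (I a) + p j) = p (I a) + p j := by
      have h2 : (2 : ZMod 2) = 0 := rfl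
      linear_combination tensorParity p k I * h2
    rw [h2]
    exact hX _ _
  · rw [tailSlot_apply_eq_zero p h]
    exact zero_mem _

theorem IsEvenOperator.tensorPow [Fintype J] [SetLike.GradedMonoid gr] {X : Matrix J J R}
    (hX : IsEvenOperator p gr X) : IsEvenOperator (tensorParity p k) gr (tensorPow p k X) := by
  unfold _root_.tensorPow
  induction List.finRange k with
  | nil => exact IsEvenOperator.one
  | cons a l ih =>
    rw [List.map_cons, List.prod_cons]
    exact (hX.tailSlot a).mul ih

theorem isEvenOperator_permOperator [SetLike.GradedMonoid gr] (σ : Equiv.Perm (Fin k)) :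
    IsEvenOperator (tensorParity p k) gr (permOperator R p σ) := by
  intro I J'
  rw [permOperator_apply]
  split_ifs with h
  · rw [h, tensorParity_comp_perm, CharTwo.add_self_eq_zero, intUnits_smul_mem_iff]
    exact SetLike.GradedOne.one_mem
  · exact zero_mem _

end Even

/-! ### Cyclicity of the supertrace and conjugation invariance -/

section SuperTrace

variable {J S R : Type*} [Fintype J] [CommRing S] [Ring R] [Module S R] {p : J → ZMod 2}
  {gr : ZMod 2 → Submodule S R}

/-- Exchanging A_ij and B_ji costs the exponent (p i + p j)² = p i + p j, which replaces the weight
(-1)^(p i) by (-1)^(p j). -/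
theorem superTrace_mul_comm (hgr : IsSuperCommutative gr) {A B : Matrix J J R}
    (hA : IsEvenOperator p gr A) (hB : IsEvenOperator p gr B) :
    superTrace p (A * B) = superTrace p (B * A) := by
  simp only [superTrace, Matrix.mul_apply, Finset.smul_sum]
  rw [Finset.sum_comm]
  refine Finset.sum_congr rfl fun j _ => Finset.sum_congr rfl fun i _ => ?_
  rw [hgr _ _ _ (hA i j) _ (hB j i), smul_smul, ← uzpow_add]
  congr 2
  generalize p i = x
  generalize p j = y
  revert x y
  decide

variable [DecidableEq J] {k : ℕ}

/-- The supertrace of `P_σ X_1 ⋯ X_k`, in the sign convention of `signTwist`. -/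
def permTrace (p : J → ZMod 2) (σ : Equiv.Perm (Fin k)) (X : Matrix J J R) : R :=
  superTrace (tensorParity p k) (permOperator R p σ * tensorPow p k X)

/-- The tensor power of V passes through P_σ, moves cyclically to the end of the supertrace, and
cancels there against that of U. -/
theorem permTrace_conj [SetLike.GradedMonoid gr] (hgr : IsSuperCommutative gr)
    (σ : Equiv.Perm (Fin k)) {X U V : Matrix J J R} (hX : IsEvenOperator p gr X)
    (hU : IsEvenOperator p gr U) (hV : IsEvenOperator p gr V) (hUV : U * V = 1) :
    permTrace p σ (V * X * U) = permTrace p σ X := by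
  rw [permTrace, tensorPow_mul k hgr (hV.mul hX) hU, tensorPow_mul k hgr hV hX, ← mul_assoc,
    ← mul_assoc, permOperator_mul_tensorPow σ hgr hV, mul_assoc, mul_assoc,
    superTrace_mul_comm hgr hV.tensorPow
      ((isEvenOperator_permOperator σ).mul (hX.tensorPow.mul hU.tensorPow)), mul_assoc, mul_assoc,
    ← tensorPow_mul k hgr hU hV, hUV, tensorPow_one, mul_one, permTrace]

end SuperTrace

/-! ### Expansion of α_k over permutations -/

section Alpha

variable {J R : Type*} [Fintype J] [DecidableEq J] [Ring R] {p : J → ZMod 2}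

/-- The twist leaves the supertrace unchanged, and also the antisymmetrizer, because P_σ preserves
the parity of basis vectors. -/
theorem superAlpha_eq [Algebra ℂ R] (k : ℕ) (X : Matrix J J R) :
    superAlpha p k X = ((k.factorial : ℂ)⁻¹) •
      ∑ σ : Equiv.Perm (Fin k), Equiv.Perm.sign σ • permTrace p σ (signTwist p X) := by
  have h1 : signTwist (tensorParity p k) (antisymmetrizer R p k) = antisymmetrizer R p k := by
    refine signTwist_eq_self _ fun I J' h => ?_
    rw [antisymmetrizer, Matrix.smul_apply, Matrix.sum_apply, Finset.sum_eq_zero, smul_zero]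
    intro σ _
    rw [Matrix.smul_apply, permOperator_apply, if_neg, smul_zero]
    rintro rfl
    exact h (tensorParity_comp_perm J' σ⁻¹)
  have h2 : (List.ofFn fun a : Fin k => tensorSlot p a X).map (signTwist (tensorParity p k)) =
      (List.finRange k).map fun a => tailSlot p a (signTwist p X) := by
    rw [List.ofFn_eq_map, List.map_map]
    exact List.map_congr_left fun a _ => signTwist_tensorSlot p a X
  rw [superAlpha, ← superTrace_signTwist, signTwist_foldl_superMul, h1, h2]
  change superTrace _ (antisymmetrizer R p k * tensorPow p k (signTwist p X)) = _
  rw [antisymmetrizer, smul_mul_assoc, Finset.sum_mul]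
  simp only [permTrace, superTrace, Matrix.smul_apply, Matrix.sum_apply, Finset.smul_sum,
    smul_mul_assoc]
  rw [Finset.sum_comm]
  refine Finset.sum_congr rfl fun σ _ => Finset.sum_congr rfl fun I _ => ?_
  rw [smul_comm, smul_comm (Equiv.Perm.sign σ)]

theorem factorial_mul_superAlpha [Algebra ℂ R] (k : ℕ) (X : Matrix J J R) :
    (k.factorial : R) * superAlpha p k X =
      ∑ σ : Equiv.Perm (Fin k), Equiv.Perm.sign σ • permTrace p σ (signTwist p X) := by
  have h : (k.factorial : R) = algebraMap ℂ R k.factorial := by simp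
  rw [superAlpha_eq, h, ← Algebra.smul_def, smul_smul, mul_inv_cancel₀, one_smul]
  exact_mod_cast k.factorial_ne_zero

variable {R' : Type*} [Ring R'] (f : R →+* R')

theorem map_intUnits_smul (u : ℤˣ) (x : R) : f (u • x) = u • f x := by
  rw [Units.smul_def, Units.smul_def, map_zsmul]

theorem map_tailSlot {J : Type*} [DecidableEq J] {p : J → ZMod 2} {k : ℕ} (a : Fin k) (X : Matrix J J R) :
    (tailSlot p a X).map f = tailSlot p a (X.map f) := by
  ext I J'
  simp only [tailSlot, Matrix.map_apply, Matrix.of_apply, apply_ite f, map_intUnits_smul, map_zero]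

theorem map_tensorPow (k : ℕ) (X : Matrix J J R) :
    (tensorPow p k X).map f = tensorPow p k (X.map f) := by
  have h : ∀ Y : Matrix (Fin k → J) (Fin k → J) R, Y.map f = f.mapMatrix Y := fun _ => rfl
  rw [tensorPow, h, map_list_prod, List.map_map, tensorPow]
  congr 1
  exact List.map_congr_left fun a _ => map_tailSlot f a X

theorem map_permTrace {k : ℕ} (σ : Equiv.Perm (Fin k)) (X : Matrix J J R) :
    f (permTrace p σ X) = permTrace p σ (X.map f) := by
  have h1 : (permOperator R p σ).map f = permOperator R' p σ := by
    ext I J'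
    simp only [permOperator_apply, Matrix.map_apply, apply_ite f, map_intUnits_smul, map_zero,
      map_one]
  rw [permTrace, permTrace, ← map_tensorPow f, ← h1, ← Matrix.map_mul, superTrace, map_sum,
    superTrace]
  simp only [map_intUnits_smul, Matrix.map_apply]

theorem map_signTwist {J : Type*} {p : J → ZMod 2} (X : Matrix J J R) : (signTwist p X).map f = signTwist p (X.map f) := by
  ext i j
  simp only [signTwist_apply, Matrix.map_apply, map_intUnits_smul]

/-- With the denominator k! cleared, the formula has integer coefficients, so any ring homomorphism
carries it over and no ℂ-linearity has to be checked. -/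
theorem factorial_mul_map_superAlpha [Algebra ℂ R] (k : ℕ) (X : Matrix J J R) :
    (k.factorial : R') * f (superAlpha p k X) =
      ∑ σ : Equiv.Perm (Fin k), Equiv.Perm.sign σ • permTrace p σ (signTwist p (X.map f)) := by
  rw [← map_natCast f, ← map_mul, factorial_mul_superAlpha, map_sum]
  simp only [map_intUnits_smul, map_permTrace, map_signTwist]

/-- The supertrace of `P_σ X_1 ⋯ X_k` for a diagonal supermatrix `X`. -/
theorem permTrace_diagonal {k : ℕ} (σ : Equiv.Perm (Fin k)) (d : J → R) :
    permTrace p σ (Matrix.diagonal d) = ∑ I : Fin k → J, if I ∘ σ = I then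
      ((-1 : ℤˣ) ^ (tensorParity p k I + inversionParity σ (p ∘ I))) •
        ((List.finRange k).map fun a => d (I a)).prod else 0 := by
  rw [permTrace, superTrace]
  refine Finset.sum_congr rfl fun I _ => ?_
  rw [tensorPow_diagonal, Matrix.mul_diagonal, permOperator_apply]
  have h : I = I ∘ ⇑σ⁻¹ ↔ I ∘ σ = I := by
    constructor
    · intro h
      nth_rw 1 [h]
      ext; simp
    · intro h
      nth_rw 2 [← h]
      ext; simp
  simp only [h]
  split_ifs
  · rw [smul_mul_assoc, one_mul, smul_smul, ← uzpow_add]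
  · rw [zero_mul, smul_zero]

end Alpha

/-! ### Character sums over stabilizers -/

section StabilizerSign

theorem uzpow_sum {ι : Type*} (s : Finset ι) (f : ι → ZMod 2) (u : ℤˣ) :
    u ^ (∑ i ∈ s, f i) = ∏ i ∈ s, u ^ f i := by
  classical
  induction s using Finset.induction_on with
  | empty => simp
  | insert a s ha ih => rw [Finset.sum_insert ha, Finset.prod_insert ha, uzpow_add, ih]

theorem inversionParity_eq_sum {k : ℕ} (σ : Equiv.Perm (Fin k)) (u : Fin k → ZMod 2) :
    inversionParity σ u = ∑ j, ∑ i ∈ Finset.Iio j, if σ j < σ i then u i * u j else 0 := by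
  rw [inversionParity, Finset.sum_filter, Fintype.sum_prod_type, Finset.sum_comm]
  refine Finset.sum_congr rfl fun j _ => ?_
  have h : Finset.Iio j = Finset.univ.filter (· < j) := by ext; simp
  rw [h, Finset.sum_filter]
  refine Finset.sum_congr rfl fun i _ => ?_
  by_cases hij : i < j <;> simp [hij]

/-- A permutation which fixes all even positions has as many inversions, modulo two, as it has
inversions between odd positions. -/
theorem sign_eq_neg_one_pow_inversionParity {k : ℕ} (σ : Equiv.Perm (Fin k)) (u : Fin k → ZMod 2)
    (h0 : ∀ a, u a = 0 → σ a = a) (h1 : ∀ a, u (σ a) = u a) :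
    Equiv.Perm.sign σ = (-1 : ℤˣ) ^ inversionParity σ u := by
  -- The sign function of the total order that puts all even positions before all odd ones. Since σ
  -- fixes the even positions and preserves parity, it can reverse only odd pairs in this order.
  set f : Fin k → Fin k → ℤ := fun i j =>
    if u i = u j then (if i < j then 1 else if j < i then -1 else 0)
    else if u i = 0 then 1 else -1 with hf
  have z2 : ∀ x : ZMod 2, x = 0 ∨ x = 1 := by decide
  have hanti : ∀ i j, f i j = -f j i := by
    intro i j
    rcases z2 (u i) with hi | hi <;> rcases z2 (u j) with hj | hj <;> simp only [hf, hi, hj]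
    · rcases lt_trichotomy i j with h | h | h <;> simp [h, h.not_gt]
    · simp
    · simp
    · rcases lt_trichotomy i j with h | h | h <;> simp [h, h.not_gt]
  have hne : ∏ j, ∏ i ∈ Finset.Iio j, f i j ≠ 0 := by
    refine Finset.prod_ne_zero_iff.2 fun j _ => Finset.prod_ne_zero_iff.2 fun i hi => ?_
    have hij : i < j := Finset.mem_Iio.1 hi
    simp only [hf, hij, if_true]
    split_ifs <;> simp
  have key : ∏ j, ∏ i ∈ Finset.Iio j, f (σ i) (σ j) =
      (((-1 : ℤˣ) ^ inversionParity σ u : ℤˣ) : ℤ) * ∏ j, ∏ i ∈ Finset.Iio j, f i j := by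
    rw [inversionParity_eq_sum, uzpow_sum, Units.coe_prod, ← Finset.prod_mul_distrib]
    refine Finset.prod_congr rfl fun j _ => ?_
    rw [uzpow_sum, Units.coe_prod, ← Finset.prod_mul_distrib]
    refine Finset.prod_congr rfl fun i hi => ?_
    have hij : i < j := Finset.mem_Iio.1 hi
    rcases z2 (u i) with hi | hi <;> rcases z2 (u j) with hj | hj <;>
      simp only [hf, hi, hj, h1]
    · simp [h0 i hi, h0 j hj, hij]
    · simp
    · simp
    · have hs : σ i ≠ σ j := fun e => hij.ne (σ.injective e)
      rcases hs.lt_or_gt with h | h <;> simp [h, h.not_gt, hij]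
  rw [σ.prod_Iio_comp_eq_sign_mul_prod hanti] at key
  exact Units.ext (mul_right_cancel₀ hne (by simpa using key))

/-- Pairs with nonzero weight have both positions odd; σ keeps them odd, so their images are
untouched by the swap. -/
theorem inversionParity_swap_mul {k : ℕ} (σ : Equiv.Perm (Fin k)) (u : Fin k → ZMod 2)
    (h1 : ∀ a, u (σ a) = u a) {a b : Fin k} (ha : u a = 0) (hb : u b = 0) :
    inversionParity (Equiv.swap a b * σ) u = inversionParity σ u := by
  rw [inversionParity_eq_sum, inversionParity_eq_sum]
  refine Finset.sum_congr rfl fun j _ => Finset.sum_congr rfl fun i _ => ?_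
  by_cases hi : u i = 0
  · simp [hi]
  by_cases hj : u j = 0
  · simp [hj]
  have h : ∀ c, u c ≠ 0 → Equiv.swap a b (σ c) = σ c := fun c hc =>
    Equiv.swap_apply_of_ne_of_ne (fun e => hc (by rw [← h1, e, ha]))
      (fun e => hc (by rw [← h1, e, hb]))
  rw [Equiv.Perm.mul_apply, Equiv.Perm.mul_apply, h i hi, h j hj]

variable {J : Type*} [Fintype J] [DecidableEq J]

/-- The sum of the character by which the stabilizer of `I` acts on `e_I`, twisted by the sign. -/
theorem sum_stabilizer_sign (p : J → ZMod 2) {k : ℕ} (I : Fin k → J) :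
    ∑ σ : Equiv.Perm (Fin k), (if I ∘ σ = I then
      (Equiv.Perm.sign σ * (-1 : ℤˣ) ^ inversionParity σ (p ∘ I) : ℤˣ) else 0 : ℤ) =
    if ∀ j, p j = 0 → (Finset.univ.filter (I · = j)).card ≤ 1 then
      ((∏ j, (Finset.univ.filter (I · = j)).card.factorial : ℕ) : ℤ) else 0 := by
  have hI : ∀ σ : Equiv.Perm (Fin k), I ∘ σ = I → ∀ a, (p ∘ I) (σ a) = (p ∘ I) a :=
    fun σ h a => congrArg p (congrFun h a)
  split_ifs with h
  · have hcard := DomMulAct.stabilizer_card I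
    simp only [Fintype.card_subtype] at hcard
    rw [← hcard, ← Finset.sum_filter, Finset.cast_card]
    refine Finset.sum_congr rfl fun σ hσ => ?_
    have hσ' : I ∘ σ = I := (Finset.mem_filter.1 hσ).2
    -- An even index occurs at most once, so the stabilizer fixes its position; every term is then 1
    -- and the sum counts the stabilizer.
    rw [sign_eq_neg_one_pow_inversionParity σ (p ∘ I) (fun a ha => ?_) (hI σ hσ'),
      Int.units_mul_self, Units.val_one]
    exact Finset.card_le_one.1 (h (I a) ha) _ (by simpa using congrFun hσ' a) _ (by simp)
  · push Not at h
    obtain ⟨j, hj, hc⟩ := h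
    obtain ⟨a, ha, b, hb, hab⟩ := Finset.one_lt_card.1 hc
    have ha' : I a = j := by simpa using ha
    have hb' : I b = j := by simpa using hb
    have hs : I ∘ (Equiv.swap a b) = I := by
      ext c
      simp only [Function.comp_apply, Equiv.swap_apply_def]
      split_ifs with h1 h2
      · rw [h1, ha', hb']
      · rw [h2, ha', hb']
      · rfl
    -- Multiplication by the transposition of two positions with the same even index preserves the
    -- stabilizer and negates every term.
    refine self_eq_neg.1 ?_
    rw [← Finset.sum_neg_distrib]
    nth_rw 1 [← Equiv.sum_comp (Equiv.mulLeft (Equiv.swap a b))]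
    refine Finset.sum_congr rfl fun σ _ => ?_
    have h1 : I ∘ ⇑(Equiv.mulLeft (Equiv.swap a b) σ) = I ∘ σ := by
      rw [Equiv.coe_mulLeft, Equiv.Perm.coe_mul, ← Function.comp_assoc, hs]
    rw [h1]
    split_ifs with hσ
    · rw [Equiv.coe_mulLeft, inversionParity_swap_mul σ (p ∘ I) (hI σ hσ) (by simpa [ha'])
        (by simpa [hb']), Equiv.Perm.sign_mul, Equiv.Perm.sign_swap hab]
      simp
    · simp

end StabilizerSign

/-! ### From multi-indices to generating series -/

section Content

variable {J C : Type*} [Fintype J] [DecidableEq J] [CommRing C]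

/-- The summand depends only on the content of I, so the left side is a linear functional on
polynomials applied to (∑ X_j)^k. In the multinomial theorem the factorials cancel the denominator
of each multinomial coefficient and leave k!; nothing is divided in C. -/
theorem sum_prod_factorial_mul (φ : J → ℕ → C) (k : ℕ) :
    ∑ I : Fin k → J, ∏ j, ((Finset.univ.filter (I · = j)).card.factorial : C) *
        φ j (Finset.univ.filter (I · = j)).card =
      k.factorial * PowerSeries.coeff k (∏ j, PowerSeries.mk (φ j)) := by
  set F : (J →₀ ℕ) → C := fun c => ∏ j, ((c j).factorial : C) * φ j (c j) with hF
  set ψ : MvPolynomial J ℤ →ₗ[ℤ] C := (MvPolynomial.basisMonomials J ℤ).constr ℤ F with hψ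
  have hψm : ∀ c, ψ (MvPolynomial.monomial c 1) = F c := fun c => by
    rw [hψ, ← Module.Basis.constr_basis (MvPolynomial.basisMonomials J ℤ) ℤ F c,
      MvPolynomial.coe_basisMonomials]
  have h1 : ∀ I : Fin k → J, ψ (∏ a, MvPolynomial.X (I a)) =
      ∏ j, ((Finset.univ.filter (I · = j)).card.factorial : C) *
        φ j (Finset.univ.filter (I · = j)).card := by
    intro I
    have : (∏ a, MvPolynomial.X (I a) : MvPolynomial J ℤ) =
        MvPolynomial.monomial (∑ a, Finsupp.single (I a) 1) 1 := by
      rw [MvPolynomial.monomial_sum_one]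
      rfl
    rw [this, hψm, hF]
    refine Finset.prod_congr rfl fun j _ => ?_
    have hc : (∑ a, Finsupp.single (I a) 1 : J →₀ ℕ) j = (Finset.univ.filter (I · = j)).card := by
      rw [Finsupp.finsetSum_apply, Finset.card_filter]
      exact Finset.sum_congr rfl fun a _ => by rw [Finsupp.single_apply]
    rw [hc]
  simp only [← h1]
  rw [← map_sum, ← Fintype.sum_pow, Finset.sum_pow_eq_sum_piAntidiag, map_sum,
    PowerSeries.coeff_prod, Finset.mul_sum]
  refine Finset.sum_nbij' (fun c => Finsupp.equivFunOnFinite.symm c) (fun c => ⇑c) ?_ ?_ ?_ ?_ ?_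
  · intro c hc
    rw [Finset.mem_piAntidiag] at hc
    rw [Finset.mem_finsuppAntidiag]
    exact ⟨by simpa using hc.1, Finset.subset_univ _⟩
  · intro c hc
    rw [Finset.mem_finsuppAntidiag] at hc
    rw [Finset.mem_piAntidiag]
    exact ⟨hc.1, fun _ _ => Finset.mem_univ _⟩
  · intro c _; rfl
  · intro c _; ext; rfl
  · intro c hc
    have hck : ∑ j, c j = k := (Finset.mem_piAntidiag.1 hc).1
    have hm : (∏ j, MvPolynomial.X j ^ c j : MvPolynomial J ℤ) =
        MvPolynomial.monomial (Finsupp.equivFunOnFinite.symm c) 1 := by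
      rw [MvPolynomial.monomial_eq, Finsupp.prod_fintype _ _ (fun _ => pow_zero _)]
      simp
    have hspec := Nat.multinomial_spec Finset.univ c
    rw [hck] at hspec
    rw [hm, ← nsmul_eq_mul, map_nsmul, hψm, nsmul_eq_mul, hF, ← hspec]
    simp only [PowerSeries.coeff_mk, Finsupp.equivFunOnFinite_symm_apply_apply]
    rw [Finset.prod_mul_distrib]
    push_cast
    ring

/-- The generating series attached to a diagonal entry `x` of a diagonal supermatrix:
`1 + x t` for an even basis vector, `(1 + x t)⁻¹` for an odd one. -/
def diagonalFactor (q : ZMod 2) (x : C) (r : ℕ) : C :=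
  if q = 0 then (if r ≤ 1 then x ^ r else 0) else (-x) ^ r

/-- For fixed I the sum over σ is the stabilizer sum of `sum_stabilizer_sign`, and the supertrace
sign is absorbed by replacing d j with -d j at odd j. The vanishing at a repeated even index matches
the truncation of `diagonalFactor` after degree one. -/
theorem sum_sign_smul_permTrace_diagonal (p : J → ZMod 2) (k : ℕ) (d : J → C) :
    ∑ σ : Equiv.Perm (Fin k), Equiv.Perm.sign σ • permTrace p σ (Matrix.diagonal d) =
      k.factorial * PowerSeries.coeff k (∏ j, PowerSeries.mk (diagonalFactor (p j) (d j))) := by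
  rw [← sum_prod_factorial_mul]
  simp only [permTrace_diagonal, Finset.smul_sum]
  rw [Finset.sum_comm]
  refine Finset.sum_congr rfl fun I _ => ?_
  have h1 : ∀ σ : Equiv.Perm (Fin k), (Equiv.Perm.sign σ • if I ∘ σ = I then
      ((-1 : ℤˣ) ^ (tensorParity p k I + inversionParity σ (p ∘ I))) •
        ((List.finRange k).map fun a => d (I a)).prod else 0) =
      ((if I ∘ σ = I then
        (Equiv.Perm.sign σ * (-1 : ℤˣ) ^ inversionParity σ (p ∘ I) : ℤˣ) else 0 : ℤ) : C) *
        (((-1 : ℤˣ) ^ tensorParity p k I) • ∏ a, d (I a)) := by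
    intro σ
    split_ifs
    · rw [← List.ofFn_eq_map, List.prod_ofFn]
      simp only [Units.smul_def, zsmul_eq_mul, uzpow_add]
      push_cast
      ring
    · simp
  simp only [h1]
  rw [← Finset.sum_mul, ← Int.cast_sum, sum_stabilizer_sign, Finset.prod_mul_distrib]
  set c : J → ℕ := fun j => (Finset.univ.filter (I · = j)).card with hc
  have h2 : (((-1 : ℤˣ) ^ tensorParity p k I) • ∏ a, d (I a)) =
      ∏ j, (if p j = 0 then d j else -d j) ^ c j := by
    have h3 : ∀ a, (if p (I a) = 0 then d (I a) else -d (I a)) =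
        (((-1 : ℤˣ) ^ p (I a) : ℤˣ) : ℤ) * d (I a) := by
      intro a
      have z2 : ∀ x : ZMod 2, x = 0 ∨ x = 1 := by decide
      rcases z2 (p (I a)) with h | h <;> simp [h]
    have h4 := Finset.prod_comp (s := Finset.univ)
      (fun j => if p j = 0 then d j else -d j) I
    simp only [h3] at h4
    rw [Finset.prod_mul_distrib] at h4
    rw [tensorParity, uzpow_sum, Units.smul_def, zsmul_eq_mul, Units.coe_prod, Int.cast_prod, h4]
    refine Finset.prod_subset (Finset.subset_univ _) fun j _ hj => ?_
    have h5 : Finset.univ.filter (I · = j) = ∅ := by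
      refine Finset.filter_eq_empty_iff.2 fun a _ e => hj ?_
      exact Finset.mem_image.2 ⟨a, Finset.mem_univ _, e⟩
    rw [h5, Finset.card_empty, pow_zero]
  rw [h2]
  split_ifs with h
  · push_cast
    congr 1
    refine Finset.prod_congr rfl fun j _ => ?_
    unfold diagonalFactor
    split_ifs with h3 h4
    · rfl
    · exact absurd (h j h3) h4
    · rfl
  · push Not at h
    obtain ⟨j, hj, hcj⟩ := h
    rw [Int.cast_zero, zero_mul]
    refine (mul_eq_zero_of_right _ (Finset.prod_eq_zero (Finset.mem_univ j) ?_)).symm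
    rw [diagonalFactor, if_pos hj, if_neg (not_le.2 hcj)]

end Content

/-! ### Toeplitz matrices and the Jacobi–Trudi determinant -/

section Toeplitz

variable {C : Type*} [CommRing C]

/-- The coefficients of a power series, indexed by the integers. -/
def intCoeff (H : PowerSeries C) (z : ℤ) : C := if 0 ≤ z then PowerSeries.coeff z.toNat H else 0

theorem intCoeff_of_neg (H : PowerSeries C) {z : ℤ} (hz : z < 0) : intCoeff H z = 0 :=
  if_neg hz.not_ge

theorem intCoeff_natCast (H : PowerSeries C) (r : ℕ) : intCoeff H r = PowerSeries.coeff r H := by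
  simp [intCoeff]

/-- The upper triangular Toeplitz matrix of a power series. -/
def toeplitz (N : ℕ) (H : PowerSeries C) : Matrix (Fin N) (Fin N) C :=
  Matrix.of fun i j => intCoeff H ((j : ℕ) - (i : ℕ) : ℤ)

/-- Only intermediate indices between i and j contribute, and they give the Cauchy product for the
coefficient of degree j - i. -/
theorem toeplitz_mul (N : ℕ) (H G : PowerSeries C) :
    toeplitz N H * toeplitz N G = toeplitz N (H * G) := by
  ext i j
  simp only [Matrix.mul_apply, toeplitz, Matrix.of_apply]
  by_cases hij : (i : ℕ) ≤ j
  · obtain ⟨r, hr⟩ := Nat.exists_eq_add_of_le hij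
    have h1 : ((j : ℕ) - (i : ℕ) : ℤ) = (r : ℕ) := by omega
    rw [h1, intCoeff_natCast, PowerSeries.coeff_mul, Fin.sum_univ_eq_sum_range
      (fun x : ℕ => intCoeff H ((x : ℤ) - (i : ℕ)) * intCoeff G ((j : ℕ) - (x : ℤ)))]
    refine (Finset.sum_of_injOn (fun x : ℕ × ℕ => (i : ℕ) + x.1) ?_ ?_ ?_ ?_).symm
    · rintro ⟨a, b⟩ hab ⟨a', b'⟩ hab' h
      have h1 : a + b = r := by simpa using hab
      have h2 : a' + b' = r := by simpa using hab'
      simp only [add_right_inj] at h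
      ext <;> simp only <;> omega
    · rintro ⟨a, b⟩ hab
      have h1 : a + b = r := by simpa using hab
      simp only [Finset.mem_coe, Finset.mem_range]
      have := j.2
      omega
    · intro x _ hx
      by_cases h2 : x < i
      · rw [intCoeff_of_neg H (by omega), zero_mul]
      · by_cases h3 : (j : ℕ) < x
        · rw [intCoeff_of_neg G (by omega), mul_zero]
        · refine absurd ⟨(x - i, j - x), ?_, ?_⟩ hx
          · have h4 : x - i + (j - x) = r := by omega
            simpa using h4
          · simp only
            omega
    · rintro ⟨a, b⟩ hab
      have h1 : a + b = r := by simpa using hab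
      have h2 : (((i : ℕ) + a : ℕ) : ℤ) - (i : ℕ) = (a : ℕ) := by push_cast; ring
      have h3 : ((j : ℕ) : ℤ) - (((i : ℕ) + a : ℕ) : ℤ) = (b : ℕ) := by omega
      simp only [h2, h3, intCoeff_natCast]
  · rw [intCoeff_of_neg _ (by omega)]
    refine Finset.sum_eq_zero fun x _ => ?_
    by_cases h2 : (x : ℕ) < i
    · rw [intCoeff_of_neg H (by omega), zero_mul]
    · rw [intCoeff_of_neg G (by omega), mul_zero]

theorem toeplitz_one (N : ℕ) : toeplitz N (1 : PowerSeries C) = 1 := by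
  ext i j
  simp only [toeplitz, Matrix.of_apply, Matrix.one_apply, intCoeff, PowerSeries.coeff_one]
  have h : i = j ↔ (i : ℕ) = j := Fin.ext_iff
  simp only [h]
  split_ifs <;> first | rfl | omega

theorem det_toeplitz (N : ℕ) {H : PowerSeries C} (hH : PowerSeries.constantCoeff H = 1) :
    (toeplitz N H).det = 1 := by
  rw [Matrix.det_of_isUpperTriangular]
  · refine Finset.prod_eq_one fun i _ => ?_
    rw [toeplitz, Matrix.of_apply, sub_self]
    simpa [intCoeff] using hH
  · intro i j hij
    rw [toeplitz, Matrix.of_apply, intCoeff_of_neg]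
    have : (j : ℕ) < i := hij
    omega

/-- The Jacobi–Trudi determinant of a column. -/
theorem det_intCoeff_one_sub_add (k : ℕ) {H G : PowerSeries C}
    (hH : PowerSeries.constantCoeff H = 1) (hHG : H * G = 1) :
    (Matrix.of fun i j : Fin k => intCoeff H ((1 : ℤ) - (i : ℕ) + (j : ℕ))).det =
      (-1) ^ k * PowerSeries.coeff k G := by
  -- The determinant is 1, so the adjugate is the inverse. Its top right corner is, up to (-1)^k,
  -- the minor without the last row and first column, which is the determinant sought.
  have h1 : (toeplitz (k + 1) H).adjugate = toeplitz (k + 1) G := by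
    have h2 : toeplitz (k + 1) H * toeplitz (k + 1) G = 1 := by
      rw [toeplitz_mul, hHG, toeplitz_one]
    calc (toeplitz (k + 1) H).adjugate
        = (toeplitz (k + 1) H).adjugate * (toeplitz (k + 1) H * toeplitz (k + 1) G) := by
          rw [h2, mul_one]
      _ = toeplitz (k + 1) G := by
          rw [← mul_assoc, Matrix.adjugate_mul, det_toeplitz _ hH, one_smul, one_mul]
  have h3 := Matrix.adjugate_fin_succ_eq_det_submatrix (toeplitz (k + 1) H) 0 (Fin.last k)
  rw [h1, toeplitz, Matrix.of_apply] at h3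
  have h4 : ((Fin.last k : ℕ) : ℤ) - ((0 : Fin (k + 1)) : ℕ) = (k : ℕ) := by simp
  rw [h4, intCoeff_natCast] at h3
  have h5 : (toeplitz (k + 1) H).submatrix (Fin.last k).succAbove (0 : Fin (k + 1)).succAbove =
      Matrix.of fun i j : Fin k => intCoeff H ((1 : ℤ) - (i : ℕ) + (j : ℕ)) := by
    ext i j
    simp only [Matrix.submatrix_apply, toeplitz, Matrix.of_apply, Fin.succAbove_last,
      Fin.succAbove_zero, Fin.val_succ, Fin.val_castSucc]
    congr 1
    push_cast
    ring
  rw [h5] at h3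
  rw [h3, ← mul_assoc, ← pow_add]
  simp [← two_mul]

end Toeplitz

/-! ### The column Schur polynomial as a coefficient -/

section SuperSchur

variable {C : Type*} [CommRing C]

theorem rescale_mk_diagonalFactor_zero (x : C) :
    PowerSeries.rescale (-1) (PowerSeries.mk (diagonalFactor 0 x)) =
      1 - PowerSeries.C x * PowerSeries.X := by
  ext r
  rw [PowerSeries.coeff_rescale, PowerSeries.coeff_mk, map_sub, PowerSeries.coeff_one,
    PowerSeries.coeff_C_mul, PowerSeries.coeff_X]
  rcases r with _ | _ | r <;> simp [diagonalFactor]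

theorem rescale_mk_diagonalFactor_one (x : C) :
    (1 - PowerSeries.C x * PowerSeries.X) *
      PowerSeries.rescale (-1) (PowerSeries.mk (diagonalFactor 1 x)) = 1 := by
  ext r
  rw [sub_mul, one_mul, mul_assoc, map_sub, PowerSeries.coeff_C_mul, PowerSeries.coeff_one]
  cases r with
  | zero => simp [diagonalFactor]
  | succ r =>
    rw [PowerSeries.coeff_succ_X_mul, PowerSeries.coeff_rescale, PowerSeries.coeff_rescale,
      PowerSeries.coeff_mk, PowerSeries.coeff_mk]
    have h : (-1 : C) ^ r * (-x) ^ r = x ^ r := by rw [← mul_pow, neg_one_mul, neg_neg]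
    simp only [diagonalFactor, one_ne_zero, if_false, Nat.succ_ne_zero, pow_succ']
    linear_combination (0 : C) * h

/-- The specialized series H is inverse to D(-t), factor by factor. The sign (-1)^k of the column
determinant cancels the one from t ↦ -t. -/
theorem map_superSchur_column {m n : ℕ} (φ : MvPolynomial (Fin m ⊕ Fin n) ℂ →+* C)
    (d : Fin m ⊕ Fin n → C) (hl : ∀ i, φ (MvPolynomial.X (Sum.inl i)) = d (Sum.inl i))
    (hr : ∀ j, φ (MvPolynomial.X (Sum.inr j)) = -d (Sum.inr j)) (k : ℕ) :
    φ (superSchur m n (fun _ : Fin k => 1)) =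
      PowerSeries.coeff k (∏ j, PowerSeries.mk (diagonalFactor (stdParity m n j) (d j))) := by
  set D := ∏ j, PowerSeries.mk (diagonalFactor (stdParity m n j) (d j)) with hD
  set H := PowerSeries.map φ (superSchurSeries m n) with hH
  have h1 : PowerSeries.constantCoeff H = 1 := by
    rw [hH, ← PowerSeries.coeff_zero_eq_constantCoeff_apply, PowerSeries.coeff_map,
      PowerSeries.coeff_zero_eq_constantCoeff_apply, superSchurSeries]
    simp
  have h2 : H * PowerSeries.rescale (-1) D = 1 := by
    rw [hH, superSchurSeries, map_mul, map_prod, map_prod, hD, map_prod, Fintype.prod_sum_type,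
      mul_mul_mul_comm, ← Finset.prod_mul_distrib, ← Finset.prod_mul_distrib,
      Finset.prod_eq_one, Finset.prod_eq_one, one_mul]
    · intro j _
      rw [map_add, map_mul, PowerSeries.map_C, PowerSeries.map_X, hr, map_one, map_neg, neg_mul,
        ← sub_eq_add_neg]
      exact rescale_mk_diagonalFactor_one _
    · intro i _
      have h3 := congrArg (PowerSeries.map φ) (PowerSeries.invOfUnit_mul
        (1 - PowerSeries.C (MvPolynomial.X (Sum.inl i) : MvPolynomial (Fin m ⊕ Fin n) ℂ) *
          PowerSeries.X) 1 (by simp))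
      rw [map_mul, map_sub, map_mul, PowerSeries.map_C, PowerSeries.map_X, hl, map_one] at h3
      rw [← h3]
      congr 1
      exact rescale_mk_diagonalFactor_zero _
  have h3 : φ (superSchur m n (fun _ : Fin k => 1)) =
      (Matrix.of fun i j : Fin k => intCoeff H ((1 : ℤ) - (i : ℕ) + (j : ℕ))).det := by
    rw [superSchur, RingHom.map_det]
    congr 1
    ext i j
    simp only [RingHom.mapMatrix_apply, Matrix.map_apply, Matrix.of_apply, superSchurRow, intCoeff,
      hH, PowerSeries.coeff_map, apply_ite φ, map_zero]
    norm_num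
  rw [h3, det_intCoeff_one_sub_add k h1 h2, PowerSeries.coeff_rescale, ← mul_assoc, ← mul_pow]
  simp

end SuperSchur

/-! ### Nilpotency of the augmentation ideal -/

section Augmentation

variable (K M : Type*) [Field K] [AddCommGroup M] [Module K M]

/-- The augmentation ideal of an exterior algebra. -/
def augmentation : Submodule K (ExteriorAlgebra K M) :=
  LinearMap.range (ExteriorAlgebra.ι K : M →ₗ[K] ExteriorAlgebra K M) * ⊤

variable {K M}

theorem mul_mem_augmentation (x : ExteriorAlgebra K M) {y : ExteriorAlgebra K M}
    (hy : y ∈ augmentation K M) : x * y ∈ augmentation K M := by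
  induction x using ExteriorAlgebra.induction generalizing y with
  | algebraMap r => rw [← Algebra.smul_def]; exact Submodule.smul_mem _ r hy
  | ι v => exact Submodule.mul_mem_mul ⟨v, rfl⟩ Submodule.mem_top
  | mul a b ha hb => rw [mul_assoc]; exact ha (hb hy)
  | add a b ha hb => rw [add_mul]; exact add_mem (ha hy) (hb hy)

theorem mem_augmentation_mul {x : ExteriorAlgebra K M} (hx : x ∈ augmentation K M)
    (y : ExteriorAlgebra K M) : x * y ∈ augmentation K M := by
  have h : augmentation K M * ⊤ ≤ augmentation K M := by
    rw [augmentation, mul_assoc]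
    exact mul_le_mul' le_rfl le_top
  exact h (Submodule.mul_mem_mul hx Submodule.mem_top)

theorem sub_algebraMapInv_mem_augmentation (x : ExteriorAlgebra K M) :
    x - algebraMap K _ (ExteriorAlgebra.algebraMapInv x) ∈ augmentation K M := by
  induction x using ExteriorAlgebra.induction with
  | algebraMap r => simp
  | ι v =>
    have h : ExteriorAlgebra.algebraMapInv (ExteriorAlgebra.ι K v) = 0 := by
      simp [ExteriorAlgebra.algebraMapInv]
    rw [h, map_zero, sub_zero, ← mul_one (ExteriorAlgebra.ι K v)]
    exact Submodule.mul_mem_mul ⟨v, rfl⟩ Submodule.mem_top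
  | mul a b ha hb =>
    have h : a * b - algebraMap K _ (ExteriorAlgebra.algebraMapInv (a * b)) =
        a * (b - algebraMap K _ (ExteriorAlgebra.algebraMapInv b)) +
          (a - algebraMap K _ (ExteriorAlgebra.algebraMapInv a)) *
            algebraMap K _ (ExteriorAlgebra.algebraMapInv b) := by
      rw [map_mul, map_mul]
      noncomm_ring
    rw [h]
    exact add_mem (mul_mem_augmentation _ hb) (mem_augmentation_mul ha _)
  | add a b ha hb =>
    rw [map_add, map_add, add_sub_add_comm]
    exact add_mem ha hb

theorem mem_augmentation_of_algebraMapInv_eq_zero {x : ExteriorAlgebra K M}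
    (hx : ExteriorAlgebra.algebraMapInv x = 0) : x ∈ augmentation K M := by
  simpa [hx] using sub_algebraMapInv_mem_augmentation x

theorem top_mul_range_ι_pow_le (r : ℕ) :
    ⊤ * LinearMap.range (ExteriorAlgebra.ι K : M →ₗ[K] ExteriorAlgebra K M) ^ r ≤
      LinearMap.range (ExteriorAlgebra.ι K : M →ₗ[K] ExteriorAlgebra K M) ^ r * ⊤ := by
  have h1 : ⊤ * LinearMap.range (ExteriorAlgebra.ι K : M →ₗ[K] ExteriorAlgebra K M) ≤
      LinearMap.range (ExteriorAlgebra.ι K : M →ₗ[K] ExteriorAlgebra K M) * ⊤ := by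
    refine Submodule.mul_le.2 fun x _ y hy => mul_mem_augmentation x ?_
    rw [← mul_one y]
    exact Submodule.mul_mem_mul hy Submodule.mem_top
  induction r with
  | zero => simp
  | succ r ih =>
    calc ⊤ * LinearMap.range (ExteriorAlgebra.ι K) ^ (r + 1)
        = ⊤ * LinearMap.range (ExteriorAlgebra.ι K) ^ r * LinearMap.range (ExteriorAlgebra.ι K) := by
          rw [pow_succ, mul_assoc]
      _ ≤ LinearMap.range (ExteriorAlgebra.ι K) ^ r * ⊤ * LinearMap.range (ExteriorAlgebra.ι K) :=
          mul_le_mul' ih le_rfl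
      _ ≤ LinearMap.range (ExteriorAlgebra.ι K) ^ r *
            (LinearMap.range (ExteriorAlgebra.ι K) * ⊤) := by
          rw [mul_assoc]
          exact mul_le_mul' le_rfl h1
      _ = LinearMap.range (ExteriorAlgebra.ι K) ^ (r + 1) * ⊤ := by rw [pow_succ, mul_assoc]

theorem augmentation_pow_le (r : ℕ) : augmentation K M ^ r ≤
    LinearMap.range (ExteriorAlgebra.ι K : M →ₗ[K] ExteriorAlgebra K M) ^ r * ⊤ := by
  induction r with
  | zero => simp only [pow_zero, one_mul]; exact le_top
  | succ r ih =>
    calc augmentation K M ^ (r + 1)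
        ≤ augmentation K M * (LinearMap.range (ExteriorAlgebra.ι K) ^ r * ⊤) := by
          rw [pow_succ']
          exact mul_le_mul' le_rfl ih
      _ = LinearMap.range (ExteriorAlgebra.ι K) *
            (⊤ * LinearMap.range (ExteriorAlgebra.ι K) ^ r) * ⊤ := by
          rw [augmentation]
          simp only [mul_assoc]
      _ ≤ LinearMap.range (ExteriorAlgebra.ι K) *
            (LinearMap.range (ExteriorAlgebra.ι K) ^ r * ⊤) * ⊤ :=
          mul_le_mul' (mul_le_mul' le_rfl (top_mul_range_ι_pow_le r)) le_rfl
      _ = LinearMap.range (ExteriorAlgebra.ι K) ^ (r + 1) * (⊤ * ⊤) := by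
          rw [pow_succ']
          simp only [mul_assoc]
      _ ≤ LinearMap.range (ExteriorAlgebra.ι K) ^ (r + 1) * ⊤ := mul_le_mul' le_rfl le_top

/-- The r-th power of the ideal lies in the right ideal generated by products of r vectors, and the
exterior power just above the top degree is zero. -/
theorem augmentation_pow_eq_bot [Module.Finite K M] :
    augmentation K M ^ (Module.finrank K M + 1) = ⊥ := by
  have h : (⋀[K]^(Module.finrank K M + 1) M) = ⊥ := by
    rw [← Submodule.finrank_eq_zero (R := K), exteriorPower.finrank_eq]
    exact Nat.choose_succ_self _
  have h2 := augmentation_pow_le (K := K) (M := M) (Module.finrank K M + 1)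
  change _ ≤ (⋀[K]^(Module.finrank K M + 1) M) * ⊤ at h2
  rw [h, Submodule.bot_mul] at h2
  exact le_bot_iff.1 h2

variable {J : Type*} [Fintype J] [DecidableEq J]

theorem isNilpotent_of_forall_algebraMapInv_eq_zero [Module.Finite K M]
    {A : Matrix J J (ExteriorAlgebra K M)}
    (hA : ∀ i j, ExteriorAlgebra.algebraMapInv (A i j) = 0) : IsNilpotent A := by
  have h : ∀ r i j, (A ^ r) i j ∈ augmentation K M ^ r := by
    intro r
    induction r with
    | zero =>
      intro i j
      rw [pow_zero, pow_zero, Matrix.one_apply]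
      split_ifs
      · exact Submodule.one_le.1 le_rfl
      · exact zero_mem _
    | succ r ih =>
      intro i j
      rw [pow_succ, pow_succ, Matrix.mul_apply]
      exact Submodule.sum_mem _ fun l _ => Submodule.mul_mem_mul (ih i l)
        (mem_augmentation_of_algebraMapInv_eq_zero (hA l j))
  refine ⟨Module.finrank K M + 1, ?_⟩
  ext i j
  have h2 := h (Module.finrank K M + 1) i j
  rw [augmentation_pow_eq_bot] at h2
  exact (Submodule.mem_bot K).1 h2

end Augmentation

/-! ### Lifting a diagonalization through a nilpotent kernel -/

section Diagonalization

variable {K M J : Type*} [Field K] [AddCommGroup M] [Module K M] [Fintype J] [DecidableEq J]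

/-- The algebra of even operators, with the product of matrices of `signTwist`. -/
def evenOperators (K M : Type*) [Field K] [AddCommGroup M] [Module K M] (p : J → ZMod 2) :
    Subalgebra K (Matrix J J (ExteriorAlgebra K M)) where
  carrier := {A | IsEvenOperator p (CliffordAlgebra.evenOdd (0 : QuadraticForm K M)) A}
  mul_mem' := IsEvenOperator.mul
  add_mem' := fun hA hB i j => add_mem (hA i j) (hB i j)
  algebraMap_mem' := fun r => by
    rw [Matrix.algebraMap_eq_diagonal]
    exact IsEvenOperator.diagonal fun _ => SetLike.algebraMap_mem_graded
      (CliffordAlgebra.evenOdd (0 : QuadraticForm K M)) r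

/-- Reduction of matrices modulo the augmentation ideal. -/
def bodyMatrix (K M J : Type*) [Field K] [AddCommGroup M] [Module K M] [Fintype J]
    [DecidableEq J] : Matrix J J (ExteriorAlgebra K M) →ₐ[K] Matrix J J K :=
  (ExteriorAlgebra.algebraMapInv : ExteriorAlgebra K M →ₐ[K] K).mapMatrix

theorem isNilpotent_of_bodyMatrix_eq_zero [Module.Finite K M]
    {A : Matrix J J (ExteriorAlgebra K M)} (hA : bodyMatrix K M J A = 0) : IsNilpotent A :=
  isNilpotent_of_forall_algebraMapInv_eq_zero fun i j => congrFun (congrFun hA i) j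

theorem aeval_diagonal (d : J → K) (q : Polynomial K) :
    Polynomial.aeval (Matrix.diagonal d) q = Matrix.diagonal fun j => q.eval (d j) := by
  have h := Polynomial.aeval_algHom_apply (Matrix.diagonalAlgHom K : (J → K) →ₐ[K] _) d q
  rw [Polynomial.aeval_pi_apply] at h
  simpa using h

/-- An even supermatrix whose body is diagonal with distinct entries can be diagonalized. -/
theorem exists_conj_eq_diagonal [Module.Finite K M] (p : J → ZMod 2)
    {X : Matrix J J (ExteriorAlgebra K M)} (hX : X ∈ evenOperators K M p) {d : J → K}
    (hd : Function.Injective d) (hXd : bodyMatrix K M J X = Matrix.diagonal d) :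
    ∃ U ∈ evenOperators K M p, ∃ V ∈ evenOperators K M p, U * V = 1 ∧ V * U = 1 ∧
      ∃ ω, V * X * U = Matrix.diagonal ω := by
  -- Idempotents lifted inside K[X] are automatically even and commute with X.
  set T := Algebra.adjoin K {X} with hT
  have hTe : T ≤ evenOperators K M p := Algebra.adjoin_le (Set.singleton_subset_iff.2 hX)
  have hTc : ∀ y ∈ T, Commute X y := fun y hy =>
    (Algebra.commute_of_mem_adjoin_singleton_of_commute hy (Commute.refl X))
  let f : T →+* Matrix J J K := ((bodyMatrix K M J).comp T.val : T →ₐ[K] _)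
  have hker : ∀ x ∈ RingHom.ker f, IsNilpotent x := by
    intro x hx
    have hx' : bodyMatrix K M J (x : Matrix J J (ExteriorAlgebra K M)) = 0 := hx
    obtain ⟨N, hN⟩ := isNilpotent_of_bodyMatrix_eq_zero hx'
    exact ⟨N, Subtype.ext (by simpa using hN)⟩
  have he : OrthogonalIdempotents fun i : J => Matrix.diagonal (Pi.single i (1 : K)) :=
    (CompleteOrthogonalIdempotents.single fun _ : J => K).1.map (Matrix.diagonalRingHom J K)
  have he' : ∀ i : J, Matrix.diagonal (Pi.single i (1 : K)) ∈ f.range := by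
    intro i
    -- The Lagrange polynomial that is 1 at d i and 0 at the other d j sends X to an element whose
    -- body is the i-th diagonal idempotent.
    refine ⟨Polynomial.aeval (⟨X, Algebra.self_mem_adjoin_singleton K X⟩ : T)
      (Lagrange.basis Finset.univ d i), ?_⟩
    change ((bodyMatrix K M J).comp T.val) _ = _
    rw [← Polynomial.aeval_algHom_apply]
    change Polynomial.aeval (bodyMatrix K M J X) _ = _
    rw [hXd, aeval_diagonal]
    congr 1
    ext j
    by_cases hij : i = j
    · subst hij
      rw [Pi.single_eq_same, Lagrange.eval_basis_self hd.injOn (Finset.mem_univ _)]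
    · rw [Pi.single_eq_of_ne' hij, Lagrange.eval_basis_of_ne hij (Finset.mem_univ _)]
  obtain ⟨e, hoe, hfe⟩ := he.lift_of_isNilpotent_ker f hker he'
  set E : J → Matrix J J (ExteriorAlgebra K M) := fun i => Matrix.diagonal (Pi.single i 1) with hE
  have hoE : CompleteOrthogonalIdempotents E :=
    (CompleteOrthogonalIdempotents.single fun _ : J => ExteriorAlgebra K M).map
      (Matrix.diagonalRingHom J (ExteriorAlgebra K M))
  have hEe : ∀ i, E i ∈ evenOperators K M p := by
    intro i
    refine IsEvenOperator.diagonal fun j => ?_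
    by_cases hij : i = j
    · subst hij
      rw [Pi.single_eq_same]
      exact SetLike.GradedOne.one_mem
    · rw [Pi.single_eq_of_ne' hij]
      exact zero_mem _
  have hbE : ∀ i, bodyMatrix K M J (E i) = Matrix.diagonal (Pi.single i (1 : K)) := by
    intro i
    rw [hE, bodyMatrix, AlgHom.mapMatrix_apply, Matrix.diagonal_map (map_zero _)]
    congr 1
    ext j
    by_cases hij : i = j
    · subst hij; simp
    · simp [Pi.single_eq_of_ne' hij]
  -- The standard intertwiner of two families of orthogonal idempotents: e_j U = e_j E_j = U E_j.
  -- Both families have the same body, so U has body 1.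
  set U : Matrix J J (ExteriorAlgebra K M) := ∑ i, (e i : Matrix J J _) * E i with hU
  have hUe : U ∈ evenOperators K M p :=
    Subalgebra.sum_mem _ fun i _ => mul_mem (hTe (e i).2) (hEe i)
  have hbU : bodyMatrix K M J (U - 1) = 0 := by
    rw [map_sub, map_one, hU, map_sum, sub_eq_zero, ← map_one (bodyMatrix K M J), ← hoE.complete,
      map_sum]
    refine Finset.sum_congr rfl fun i _ => ?_
    have h1 : bodyMatrix K M J (e i : Matrix J J _) = Matrix.diagonal (Pi.single i (1 : K)) :=
      congrFun hfe i
    rw [map_mul, h1, hbE]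
    exact he.idem i
  -- Invertibility is proved inside the subalgebra, so the inverse is even as well.
  have hUnit : IsUnit (⟨U, hUe⟩ : evenOperators K M p) := by
    obtain ⟨N, hN⟩ := isNilpotent_of_bodyMatrix_eq_zero hbU
    have h1 : IsNilpotent ((⟨U, hUe⟩ : evenOperators K M p) - 1) :=
      ⟨N, Subtype.ext (by simpa using hN)⟩
    simpa using h1.isUnit_add_one
  obtain ⟨W, hW1, hW2⟩ := isUnit_iff_exists.1 hUnit
  obtain ⟨V, hVe⟩ := W
  have hUV : U * V = 1 := congrArg Subtype.val hW1
  have hVU : V * U = 1 := congrArg Subtype.val hW2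
  have hUE : ∀ j, U * E j = (e j : Matrix J J _) * E j := by
    intro j
    rw [hU, Finset.sum_mul, Finset.sum_eq_single j]
    · rw [mul_assoc, (hoE.idem j).eq]
    · intro i _ hij
      rw [mul_assoc, hoE.ortho hij, mul_zero]
    · simp
  have heU : ∀ j, (e j : Matrix J J _) * U = (e j : Matrix J J _) * E j := by
    intro j
    rw [hU, Finset.mul_sum, Finset.sum_eq_single j]
    · rw [← mul_assoc]
      congr 1
      exact congrArg Subtype.val (hoe.idem j).eq
    · intro i _ hij
      rw [← mul_assoc]
      have h0 : (e j : Matrix J J (ExteriorAlgebra K M)) * e i = 0 :=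
        congrArg Subtype.val (hoe.ortho hij.symm)
      rw [h0, zero_mul]
    · simp
  -- X commutes with e_j, so its conjugate commutes with every E_j and must be diagonal.
  have hcomm : ∀ j, V * X * U * E j = E j * (V * X * U) := by
    intro j
    have h1 : E j * V = V * (e j : Matrix J J _) := by
      calc E j * V = V * U * (E j * V) := by rw [hVU, one_mul]
        _ = V * (U * E j) * V := by simp only [mul_assoc]
        _ = V * e j * (U * V) := by rw [hUE, ← heU]; simp only [mul_assoc]
        _ = V * e j := by rw [hUV, mul_one]
    calc V * X * U * E j = V * X * (U * E j) := by simp only [mul_assoc]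
      _ = V * (X * e j) * U := by rw [hUE, ← heU]; simp only [mul_assoc]
      _ = V * e j * X * U := by rw [(hTc _ (e j).2).eq]; simp only [mul_assoc]
      _ = E j * (V * X * U) := by rw [← h1]; simp only [mul_assoc]
  refine ⟨U, hUe, V, hVe, hUV, hVU, fun j => (V * X * U) j j, ?_⟩
  ext i j
  by_cases hij : i = j
  · subst hij
    rw [Matrix.diagonal_apply_eq]
  · rw [Matrix.diagonal_apply_ne _ hij]
    have h1 := congrFun (congrFun (hcomm j) i) j
    rw [hE, Matrix.mul_diagonal, Matrix.diagonal_mul, Pi.single_eq_same, mul_one,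
      Pi.single_eq_of_ne hij, zero_mul] at h1
    exact h1

end Diagonalization

/-! ### Separability under specialization, and diagonalization over K -/

section Separable

open Polynomial

theorem isUnit_resultant_iff_isCoprime_of_natDegree_le {R : Type*} [CommRing R] {f g : R[X]}
    (hf : f.Monic) {n : ℕ} (hg : g.natDegree ≤ n) :
    IsUnit (resultant f g f.natDegree n) ↔ IsCoprime f g := by
  obtain ⟨k, rfl⟩ := Nat.exists_eq_add_of_le hg
  rw [resultant_add_right_deg _ _ _ _ _ le_rfl, coeff_natDegree, hf.leadingCoeff, one_pow, one_mul,
    isUnit_resultant_iff_isCoprime hf]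

/-- The derivative may drop in degree under χ, so the resultant uses a fixed degree bound for it and
thus commutes with χ. For monic f, raising the bound multiplies the resultant only by powers of 1.
-/
theorem separable_map_iff_resultant_ne_zero {R k : Type*} [CommRing R] [Field k] (χ : R →+* k)
    {f : R[X]} (hf : f.Monic) :
    (f.map χ).Separable ↔ χ (resultant f (derivative f) f.natDegree f.natDegree) ≠ 0 := by
  have h1 : (derivative (f.map χ)).natDegree ≤ (f.map χ).natDegree :=
    (natDegree_derivative_le _).trans (Nat.sub_le _ _)
  rw [Polynomial.Separable, ← isUnit_resultant_iff_isCoprime_of_natDegree_le (hf.map χ) h1,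
    hf.natDegree_map, derivative_map, resultant_map_map, isUnit_iff_ne_zero]

/-- If a monic polynomial has a separable specialization, it is separable. -/
theorem separable_map_of_separable_map {R k K : Type*} [CommRing R] [Field k] [Field K]
    (φ : R →+* k) (ψ : R →+* K) (hψ : Function.Injective ψ) {f : R[X]} (hf : f.Monic)
    (h : (f.map φ).Separable) : (f.map ψ).Separable := by
  rw [separable_map_iff_resultant_ne_zero _ hf] at h ⊢
  exact (map_ne_zero_iff ψ hψ).2 fun h0 => h (by rw [h0, map_zero])

/-- A matrix with separable characteristic polynomial over an algebraically closed field can be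
diagonalized. -/
theorem exists_conj_eq_diagonal_of_separable {K ι : Type*} [Field K] [IsAlgClosed K] [Fintype ι]
    [DecidableEq ι] (A : Matrix ι ι K) (hA : A.charpoly.Separable) :
    ∃ (d : ι → K) (U V : Matrix ι ι K), U * V = 1 ∧ V * U = 1 ∧ V * A * U = Matrix.diagonal d ∧
      A.charpoly = ∏ i, (X - C (d i)) := by
  classical
  have hcard : Fintype.card {x // x ∈ A.charpoly.roots.toFinset} = Fintype.card ι := by
    rw [Fintype.card_coe, Multiset.toFinset_card_of_nodup (nodup_roots hA),
      ← (IsAlgClosed.splits A.charpoly).natDegree_eq_card_roots, Matrix.charpoly_natDegree_eq_dim]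
  set d : ι → K := fun i => (Fintype.equivOfCardEq hcard).symm i with hd
  have hdinj : Function.Injective d :=
    Subtype.val_injective.comp (Fintype.equivOfCardEq hcard).symm.injective
  have hv : ∀ i, ∃ v : ι → K, v ≠ 0 ∧ A.mulVec v = d i • v := by
    intro i
    have hroot : A.charpoly.IsRoot (d i) := by
      have := ((Fintype.equivOfCardEq hcard).symm i).2
      rw [Multiset.mem_toFinset] at this
      exact isRoot_of_mem_roots this
    rw [Polynomial.IsRoot, Matrix.eval_charpoly] at hroot
    obtain ⟨v, hv0, hv⟩ := Matrix.exists_mulVec_eq_zero_iff.2 hroot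
    refine ⟨v, hv0, ?_⟩
    rw [Matrix.sub_mulVec, sub_eq_zero] at hv
    rw [← hv]
    simp [Matrix.scalar_apply, ← Matrix.smul_one_eq_diagonal, Matrix.smul_mulVec]
  choose v hv0 hv using hv
  have hlin : LinearIndependent K v :=
    Module.End.eigenvectors_linearIndependent' (Matrix.toLin' A) d hdinj v fun i =>
      ⟨Module.End.mem_eigenspace_iff.2 (by rw [Matrix.toLin'_apply, hv]), hv0 i⟩
  set U : Matrix ι ι K := Matrix.of fun a i => v i a with hU
  have hUunit : IsUnit U := Matrix.linearIndependent_cols_iff_isUnit.1 hlin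
  obtain ⟨u, hu⟩ := hUunit
  have hAU : A * U = U * Matrix.diagonal d := by
    ext a i
    have h1 := congrFun (hv i) a
    rw [Matrix.mul_diagonal]
    rw [Pi.smul_apply, smul_eq_mul, mul_comm] at h1
    exact h1
  have hVAU : (u⁻¹ : (Matrix ι ι K)ˣ).1 * A * U = Matrix.diagonal d := by
    rw [mul_assoc, hAU, ← mul_assoc, ← hu, Units.inv_mul, one_mul]
  refine ⟨d, U, (u⁻¹ : (Matrix ι ι K)ˣ).1, ?_, ?_, hVAU, ?_⟩
  · rw [← hu, Units.mul_inv]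
  · rw [← hu, Units.inv_mul]
  · rw [← Matrix.charpoly_diagonal, ← hVAU, Matrix.charpoly_mul_comm, ← mul_assoc, ← hu,
      Units.mul_inv, one_mul]

end Separable

/-! ### Supercommutativity of the exterior algebra -/

section ExteriorGrading

/-- Products of two vectors are central, so they can be stripped from both arguments until only two
anticommuting vectors remain. -/
theorem odd_mul_eq_neg_mul {K M : Type*} [CommRing K] [AddCommGroup M] [Module K M]
    {x y : ExteriorAlgebra K M}
    (hx : x ∈ CliffordAlgebra.evenOdd (0 : QuadraticForm K M) 1)
    (hy : y ∈ CliffordAlgebra.evenOdd (0 : QuadraticForm K M) 1) : x * y = -(y * x) := by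
  have heven : ∀ (a b : M) (z : ExteriorAlgebra K M),
      Commute (CliffordAlgebra.ι (0 : QuadraticForm K M) a * CliffordAlgebra.ι 0 b) z :=
    fun a b z => even_commute (CliffordAlgebra.ι_mul_ι_mem_evenOdd_zero _ a b) z
  induction x, hx using CliffordAlgebra.odd_induction with
  | ι v =>
    induction y, hy using CliffordAlgebra.odd_induction with
    | ι w => exact eq_neg_of_add_eq_zero_left (ExteriorAlgebra.ι_add_mul_swap v w)
    | add y z hy hz h1 h2 => rw [mul_add, add_mul, h1, h2, neg_add]
    | ι_mul_ι_mul a b y hy h =>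
      rw [← mul_assoc, ← (heven a b _).eq, mul_assoc, h, mul_neg, mul_assoc,
        mul_assoc, mul_assoc]
  | add x z hx hz h1 h2 => rw [mul_add, add_mul, h1, h2, neg_add]
  | ι_mul_ι_mul a b x hx h =>
    rw [mul_assoc, h, mul_neg, ← mul_assoc, (heven a b y).eq, mul_assoc]

theorem isSuperCommutative_evenOdd (K M : Type*) [CommRing K] [AddCommGroup M] [Module K M] :
    IsSuperCommutative (R := ExteriorAlgebra K M)
      (CliffordAlgebra.evenOdd (0 : QuadraticForm K M)) := by
  intro i j x hx y hy
  have z2 : ∀ x : ZMod 2, x = 0 ∨ x = 1 := by decide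
  rcases z2 i with rfl | rfl
  · rw [zero_mul, uzpow_zero, one_smul]
    exact even_commute hx y
  · rcases z2 j with rfl | rfl
    · rw [mul_zero, uzpow_zero, one_smul]
      exact (even_commute hy x).symm
    · rw [mul_one, uzpow_one, Units.neg_smul, one_smul]
      exact odd_mul_eq_neg_mul hx hy

/-- The inclusion of the even part. -/
def evenPartInclusion (K M : Type*) [CommRing K] [AddCommGroup M] [Module K M] :
    EvenPart K M →+* ExteriorAlgebra K M :=
  (CliffordAlgebra.even (0 : QuadraticForm K M)).val.toRingHom

end ExteriorGrading

/-! ### The generic supermatrix and its eigenvalues -/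

section Generic

theorem exteriorExtendScalars_algebraMap (S K ι : Type*) [CommRing S] [CommRing K] [Algebra S K]
    (x : S) : exteriorExtendScalars S K ι (algebraMap S _ x) =
      algebraMap K _ (algebraMap S K x) := by
  rw [← IsScalarTower.algebraMap_apply]
  exact AlgHom.commutes _ x

theorem exteriorExtendScalars_ι (S K ι : Type*) [CommRing S] [CommRing K] [Algebra S K]
    (v : ι → S) : exteriorExtendScalars S K ι (ExteriorAlgebra.ι S v) =
      ExteriorAlgebra.ι K ((Algebra.linearMap S K).compLeft ι v) :=
  ExteriorAlgebra.lift_ι_apply _ _ _ _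

variable (m n : ℕ)

theorem genericSupermatrix_map_inl_inl (i j : Fin m) :
    (genericSupermatrix m n).map (coordToExt m n) (Sum.inl i) (Sum.inl j) =
      algebraMap (EigenField m n) _ (algebraMap (EvenCoord m n) (EigenField m n)
        (MvPolynomial.X (Sum.inl (i, j)))) :=
  exteriorExtendScalars_algebraMap _ _ _ _

theorem genericSupermatrix_map_inr_inr (i j : Fin n) :
    (genericSupermatrix m n).map (coordToExt m n) (Sum.inr i) (Sum.inr j) =
      algebraMap (EigenField m n) _ (algebraMap (EvenCoord m n) (EigenField m n)
        (MvPolynomial.X (Sum.inr (i, j)))) :=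
  exteriorExtendScalars_algebraMap _ _ _ _

theorem exists_genericSupermatrix_map_inl_inr (i : Fin m) (j : Fin n) :
    ∃ v, (genericSupermatrix m n).map (coordToExt m n) (Sum.inl i) (Sum.inr j) =
      ExteriorAlgebra.ι (EigenField m n) v :=
  ⟨_, exteriorExtendScalars_ι _ _ _ _⟩

theorem exists_genericSupermatrix_map_inr_inl (i : Fin n) (j : Fin m) :
    ∃ v, (genericSupermatrix m n).map (coordToExt m n) (Sum.inr i) (Sum.inl j) =
      ExteriorAlgebra.ι (EigenField m n) v :=
  ⟨_, exteriorExtendScalars_ι _ _ _ _⟩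

/-- The generic supermatrix in the sign convention of `signTwist`. -/
def twistedGeneric : Matrix (Fin m ⊕ Fin n) (Fin m ⊕ Fin n) (ExtSuperalgebra m n) :=
  signTwist (stdParity m n) ((genericSupermatrix m n).map (coordToExt m n))

theorem twistedGeneric_mem :
    twistedGeneric m n ∈ evenOperators (EigenField m n) (OddIdx m n → EigenField m n)
      (stdParity m n) := by
  refine isEvenOperator_signTwist_iff.2 fun i j => ?_
  have h0 : ∀ x, algebraMap (EigenField m n) (ExtSuperalgebra m n) x ∈ extGrading m n 0 :=
    fun x => SetLike.algebraMap_mem_graded (extGrading m n) x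
  have h1 : ∀ v, ExteriorAlgebra.ι (EigenField m n) v ∈ extGrading m n 1 :=
    fun v => CliffordAlgebra.ι_mem_evenOdd_one _ v
  rcases i with i | i <;> rcases j with j | j
  · rw [genericSupermatrix_map_inl_inl]
    exact h0 _
  · obtain ⟨v, hv⟩ := exists_genericSupermatrix_map_inl_inr m n i j
    rw [hv]
    exact h1 v
  · obtain ⟨v, hv⟩ := exists_genericSupermatrix_map_inr_inl m n i j
    rw [hv]
    exact h1 v
  · rw [genericSupermatrix_map_inr_inr]
    exact h0 _

/-- The even diagonal block of the generic supermatrix. -/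
def genericEvenBlock : Matrix (Fin m) (Fin m) (EvenCoord m n) :=
  Matrix.of fun i j => MvPolynomial.X (Sum.inl (i, j))

/-- The odd diagonal block of the generic supermatrix. -/
def genericOddBlock : Matrix (Fin n) (Fin n) (EvenCoord m n) :=
  Matrix.of fun i j => MvPolynomial.X (Sum.inr (i, j))

/-- The off-diagonal blocks consist of odd vectors, which reduce to zero; the twist is trivial on
the diagonal blocks. -/
theorem bodyMatrix_twistedGeneric :
    bodyMatrix (EigenField m n) (OddIdx m n → EigenField m n) _ (twistedGeneric m n) =
      Matrix.fromBlocks ((genericEvenBlock m n).map (algebraMap _ (EigenField m n))) 0 0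
        ((genericOddBlock m n).map (algebraMap _ (EigenField m n))) := by
  set b : ExtSuperalgebra m n →+* EigenField m n :=
    (ExteriorAlgebra.algebraMapInv : ExtSuperalgebra m n →ₐ[EigenField m n] _).toRingHom with hb
  have h : ∀ v, b (ExteriorAlgebra.ι (EigenField m n) v) = 0 := fun v => by
    simp [hb, ExteriorAlgebra.algebraMapInv]
  have h' : ∀ x, b (algebraMap (EigenField m n) _ x) = x := fun x =>
    ExteriorAlgebra.algebraMap_leftInverse _ x
  change (twistedGeneric m n).map b = _
  rw [twistedGeneric, map_signTwist]
  ext i j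
  rw [signTwist_apply, Matrix.map_apply]
  rcases i with i | i <;> rcases j with j | j
  · rw [genericSupermatrix_map_inl_inl, h']
    simp [stdParity, genericEvenBlock]
  · obtain ⟨v, hv⟩ := exists_genericSupermatrix_map_inl_inr m n i j
    rw [hv, h, smul_zero, Matrix.fromBlocks_apply₁₂, Matrix.zero_apply]
  · obtain ⟨v, hv⟩ := exists_genericSupermatrix_map_inr_inl m n i j
    rw [hv, h, smul_zero, Matrix.fromBlocks_apply₂₁, Matrix.zero_apply]
  · rw [genericSupermatrix_map_inr_inr, h']
    simp [stdParity, genericOddBlock, CharTwo.add_self_eq_zero]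

theorem algebraMap_evenCoord_injective :
    Function.Injective (algebraMap (EvenCoord m n) (EigenField m n)) := by
  rw [IsScalarTower.algebraMap_eq (EvenCoord m n) (FractionRing (EvenCoord m n))]
  exact (algebraMap (FractionRing (EvenCoord m n)) (EigenField m n)).injective.comp
    (IsFractionRing.injective _ _)

open Polynomial in
theorem separable_charpoly_mul_charpoly :
    (((genericEvenBlock m n).map (algebraMap _ (EigenField m n))).charpoly *
      ((genericOddBlock m n).map (algebraMap _ (EigenField m n))).charpoly).Separable := by
  -- Specializing the blocks to diagonal matrices with entries 0, …, m-1 and m, …, m+n-1 makes all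
  -- eigenvalues distinct, within and across blocks.
  set c : Fin m ⊕ Fin n → ℂ := Sum.elim (fun i => ((i : ℕ) : ℂ)) (fun j => ((m + j : ℕ) : ℂ)) with hc
  have hcinj : Function.Injective c := by
    rintro (i | i) (j | j) h
    · simp only [hc, Sum.elim_inl, Nat.cast_inj] at h
      rw [Fin.ext h]
    · simp only [hc, Sum.elim_inl, Sum.elim_inr, Nat.cast_inj] at h
      have := i.2
      omega
    · simp only [hc, Sum.elim_inl, Sum.elim_inr, Nat.cast_inj] at h
      have := j.2
      omega
    · simp only [hc, Sum.elim_inr, Nat.cast_inj] at h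
      rw [Fin.ext (Nat.add_left_cancel h)]
  set φ : EvenCoord m n →+* ℂ := MvPolynomial.eval₂Hom (RingHom.id ℂ)
    (Sum.elim (fun x => if x.1 = x.2 then c (Sum.inl x.1) else 0)
      (fun x => if x.1 = x.2 then c (Sum.inr x.1) else 0)) with hφ
  have hA : (genericEvenBlock m n).map φ = Matrix.diagonal fun i => c (Sum.inl i) := by
    ext i j
    simp [genericEvenBlock, hφ, Matrix.diagonal_apply]
  have hD : (genericOddBlock m n).map φ = Matrix.diagonal fun i => c (Sum.inr i) := by
    ext i j
    simp [genericOddBlock, hφ, Matrix.diagonal_apply]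
  have hmonic : ((genericEvenBlock m n).charpoly * (genericOddBlock m n).charpoly).Monic :=
    (Matrix.charpoly_monic _).mul (Matrix.charpoly_monic _)
  have hsep : (((genericEvenBlock m n).charpoly * (genericOddBlock m n).charpoly).map φ).Separable :=
    by
    rw [Polynomial.map_mul, ← Matrix.charpoly_map, ← Matrix.charpoly_map, hA, hD,
      Matrix.charpoly_diagonal, Matrix.charpoly_diagonal,
      ← Fintype.prod_sum_type fun j => X - C (c j)]
    exact separable_prod_X_sub_C_iff.2 hcinj
  have h := separable_map_of_separable_map φ _ (algebraMap_evenCoord_injective m n) hmonic hsep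
  rwa [Polynomial.map_mul, ← Matrix.charpoly_map, ← Matrix.charpoly_map] at h

theorem fromBlocks_map_algebraMap_mem {K M : Type*} [Field K] [AddCommGroup M] [Module K M]
    (A : Matrix (Fin m) (Fin m) K) (D : Matrix (Fin n) (Fin n) K) :
    (Matrix.fromBlocks A 0 0 D).map (algebraMap K (ExteriorAlgebra K M)) ∈
      evenOperators K M (stdParity m n) := by
  have h0 : ∀ x, algebraMap K (ExteriorAlgebra K M) x ∈
      CliffordAlgebra.evenOdd (0 : QuadraticForm K M) 0 :=
    fun x => SetLike.algebraMap_mem_graded (CliffordAlgebra.evenOdd (0 : QuadraticForm K M)) x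
  rintro (i | i) (j | j)
  · exact h0 _
  · simp
  · simp
  · exact h0 _

theorem bodyMatrix_map_algebraMap {K M J : Type*} [Field K] [AddCommGroup M] [Module K M]
    [Fintype J] [DecidableEq J] (A : Matrix J J K) :
    bodyMatrix K M J (A.map (algebraMap K (ExteriorAlgebra K M))) = A := by
  ext i j
  exact ExteriorAlgebra.algebraMap_leftInverse M (A i j)

theorem exists_twistedGeneric_conj_eq_diagonal :
    ∃ U ∈ evenOperators (EigenField m n) (OddIdx m n → EigenField m n) (stdParity m n),
    ∃ V ∈ evenOperators (EigenField m n) (OddIdx m n → EigenField m n) (stdParity m n),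
      U * V = 1 ∧ V * U = 1 ∧ ∃ ω, V * twistedGeneric m n * U = Matrix.diagonal ω := by
  have hsep := separable_charpoly_mul_charpoly m n
  obtain ⟨a, A, A', hA, hA', ha, hac⟩ := exists_conj_eq_diagonal_of_separable _ hsep.of_mul_left
  obtain ⟨b, B, B', hB, hB', hb, hbc⟩ := exists_conj_eq_diagonal_of_separable _ hsep.of_mul_right
  rw [hac, hbc] at hsep
  -- Separability of the product, not merely of each factor, keeps the eigenvalues of the two blocks
  -- apart.
  have hinj : Function.Injective (Sum.elim a b) := by
    rw [← Polynomial.separable_prod_X_sub_C_iff, Fintype.prod_sum_type]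
    exact hsep
  set ι := algebraMap (EigenField m n) (ExtSuperalgebra m n) with hι
  set W := (Matrix.fromBlocks A 0 0 B).map ι with hW
  set W' := (Matrix.fromBlocks A' 0 0 B').map ι with hW'
  have h1 : W * W' = 1 := by
    rw [hW, hW', ← Matrix.map_mul, Matrix.fromBlocks_multiply]
    simp [hA, hB]
  have h2 : W' * W = 1 := by
    rw [hW, hW', ← Matrix.map_mul, Matrix.fromBlocks_multiply]
    simp [hA', hB']
  have hWm : W ∈ evenOperators (EigenField m n) (OddIdx m n → EigenField m n) (stdParity m n) :=
    fromBlocks_map_algebraMap_mem m n A B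
  have hWm' : W' ∈ evenOperators (EigenField m n) (OddIdx m n → EigenField m n) (stdParity m n) :=
    fromBlocks_map_algebraMap_mem m n A' B'
  have hbody : bodyMatrix (EigenField m n) (OddIdx m n → EigenField m n) _
      (W' * twistedGeneric m n * W) = Matrix.diagonal (Sum.elim a b) := by
    rw [map_mul, map_mul, bodyMatrix_twistedGeneric, hW, hW', bodyMatrix_map_algebraMap,
      bodyMatrix_map_algebraMap, Matrix.fromBlocks_multiply, Matrix.fromBlocks_multiply]
    simp only [Matrix.zero_mul, Matrix.mul_zero, add_zero, zero_add]
    rw [ha, hb, Matrix.fromBlocks_diagonal]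
  obtain ⟨U, hU, V, hV, hUV, hVU, ω, hω⟩ := exists_conj_eq_diagonal (stdParity m n)
    (mul_mem (mul_mem hWm' (twistedGeneric_mem m n)) hWm) hinj hbody
  refine ⟨W * U, mul_mem hWm hU, V * W', mul_mem hV hWm', ?_, ?_, ω, ?_⟩
  · calc W * U * (V * W') = W * (U * V) * W' := by simp only [mul_assoc]
      _ = 1 := by rw [hUV, mul_one, h1]
  · calc V * W' * (W * U) = V * (W' * W) * U := by simp only [mul_assoc]
      _ = 1 := by rw [h2, mul_one, hVU]
  · rw [← hω]
    simp only [mul_assoc]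

theorem exists_isSuperEigenvalues :
    ∃ (ω : Fin m → ExtEven m n) (ϖ : Fin n → ExtEven m n),
      IsSuperEigenvalues ((genericSupermatrix m n).map (coordToExt m n)) ω ϖ := by
  obtain ⟨U, hU, V, hV, hUV, hVU, d, hd⟩ := exists_twistedGeneric_conj_eq_diagonal m n
  have hd0 : ∀ j, d j ∈ extGrading m n 0 := by
    intro j
    have h := mul_mem (mul_mem hV (twistedGeneric_mem m n)) hU
    rw [hd] at h
    have h2 := h j j
    rwa [CharTwo.add_self_eq_zero, Matrix.diagonal_apply_eq] at h2
  refine ⟨fun i => ⟨d (Sum.inl i), hd0 _⟩, fun j => ⟨d (Sum.inr j), hd0 _⟩,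
    signTwist (stdParity m n) U, signTwist (stdParity m n) V,
    isEvenOperator_signTwist_iff.2 hU, isEvenOperator_signTwist_iff.2 hV, ?_, ?_, ?_⟩
  · apply signTwist_injective (stdParity m n)
    rw [signTwist_superMul, signTwist_signTwist, signTwist_signTwist, signTwist_one, hUV]
  · apply signTwist_injective (stdParity m n)
    rw [signTwist_superMul, signTwist_signTwist, signTwist_signTwist, signTwist_one, hVU]
  · apply signTwist_injective (stdParity m n)
    rw [signTwist_superMul, signTwist_superMul, signTwist_signTwist, signTwist_signTwist,
      signTwist_diagonal]
    refine hd.trans (congrArg _ ?_)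
    ext (j | j) <;> rfl

/-- After conjugation everything happens on a diagonal matrix with even entries. The generating
series computation is done in the commutative ring of even elements and carried into Λ by the
inclusion; k! is then cancelled, being a unit in characteristic zero. -/
theorem coordToExt_superAlpha_eq {ω : Fin m → ExtEven m n} {ϖ : Fin n → ExtEven m n}
    (h : IsSuperEigenvalues ((genericSupermatrix m n).map (coordToExt m n)) ω ϖ) (k : ℕ) :
    coordToExt m n (superAlpha (stdParity m n) k (genericSupermatrix m n)) =
      ((MvPolynomial.aeval (Sum.elim ω (fun j => -ϖ j)) (superSchur m n (fun _ : Fin k => 1)) :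
        ExtEven m n) : ExtSuperalgebra m n) := by
  obtain ⟨U, V, hU, hV, hUV, -, hd⟩ := h
  set j := evenPartInclusion (EigenField m n) (OddIdx m n → EigenField m n) with hj
  have hgr := isSuperCommutative_evenOdd (EigenField m n) (OddIdx m n → EigenField m n)
  have hd' : signTwist (stdParity m n) V * twistedGeneric m n * signTwist (stdParity m n) U =
      (Matrix.diagonal (Sum.elim ω ϖ)).map j := by
    rw [twistedGeneric, ← signTwist_superMul, ← signTwist_superMul, hd, signTwist_diagonal,
      Matrix.diagonal_map (map_zero j)]
    congr 1
    ext (i | i) <;> rfl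
  have hUV' : signTwist (stdParity m n) U * signTwist (stdParity m n) V = 1 := by
    rw [← signTwist_superMul, hUV, signTwist_one]
  have hfac : IsUnit (k.factorial : ExtSuperalgebra m n) := by
    have h1 : (k.factorial : ExtSuperalgebra m n) =
        algebraMap (EigenField m n) _ (k.factorial : EigenField m n) := by simp
    rw [h1]
    exact (IsUnit.mk0 _ (Nat.cast_ne_zero.2 k.factorial_ne_zero)).map _
  have hconj : ∀ σ : Equiv.Perm (Fin k), permTrace (stdParity m n) σ (twistedGeneric m n) =
      j (permTrace (stdParity m n) σ (Matrix.diagonal (Sum.elim ω ϖ))) := by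
    intro σ
    rw [map_permTrace, ← hd']
    exact (permTrace_conj hgr σ (twistedGeneric_mem m n) (isEvenOperator_signTwist_iff.2 hU)
      (isEvenOperator_signTwist_iff.2 hV) hUV').symm
  have hschur := map_superSchur_column
    (MvPolynomial.aeval (R := ℂ) (Sum.elim ω (fun j => -ϖ j)) : _ →ₐ[ℂ] ExtEven m n).toRingHom
    (Sum.elim ω ϖ) (fun i => by simp) (fun i => by simp) k
  refine hfac.mul_left_cancel ?_
  rw [factorial_mul_map_superAlpha]
  change ∑ σ, Equiv.Perm.sign σ • permTrace (stdParity m n) σ (twistedGeneric m n) =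
    _ * j ((MvPolynomial.aeval (R := ℂ) (Sum.elim ω (fun j => -ϖ j)) :
      _ →ₐ[ℂ] ExtEven m n).toRingHom _)
  simp only [hconj, ← map_intUnits_smul]
  rw [← map_sum, sum_sign_smul_permTrace_diagonal, hschur, map_mul, map_natCast]

end Generic
end

theorem mainTheorem9 (m n : ℕ) :
    (∃ (ω : Fin m → ExtEven m n) (ϖ : Fin n → ExtEven m n),
      IsSuperEigenvalues ((genericSupermatrix m n).map (coordToExt m n)) ω ϖ) ∧
    ∀ (ω : Fin m → ExtEven m n) (ϖ : Fin n → ExtEven m n),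
      IsSuperEigenvalues ((genericSupermatrix m n).map (coordToExt m n)) ω ϖ →
      ∀ k : ℕ, 0 < k →
        coordToExt m n (superAlpha (stdParity m n) k (genericSupermatrix m n)) =
          ((MvPolynomial.aeval (Sum.elim ω (fun j => -ϖ j)) (superSchur m n (fun _ : Fin k => 1)) :
            ExtEven m n) : ExtSuperalgebra m n) :=
  ⟨exists_isSuperEigenvalues m n, fun _ _ h k _ => coordToExt_superAlpha_eq m n h k⟩
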